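/- Let $\mathbb X$ be a complex Banach space, let $BUC(\mathbb R^+,\mathbb X)$ be the space of bounded uniformly continuous functions $[0,\infty)\to\mathbb X$ with the sup-norm, let $C_0(\mathbb R^+,\mathbb X)$ be its closed subspace of functions with $\lim_{t\to\infty}\|f(t)\|=0$, and let $\mathbb Y:=BUC(\mathbb R^+,\mathbb X)/C_0(\mathbb R^+,\mathbb X)$ with the quotient norm; the class of $f$ in $\mathbb Y$ is denoted by $\tilde f$. Let $\tilde S(1)$ be the bounded operator on $\mathbb Y$ induced by the translation $[S(1)f](s)=f(s+1)$. Let $\tilde{\mathcal D}$ be the operator on $\mathbb Y$ with domain $\{\tilde u: u,u'\in BUC(\mathbb R^+,\mathbb X)\}$ induced by $\mathcal D=d/dt$, that is, $\tilde{\mathcal D}\tilde u=\widetilde{u'}$ (this is a well-defined single-valued operator). For $f\in BUC(\mathbb R^+,\mathbb X)$ let $sp(f)$ be the set of all $\xi_0\in\mathbb R$ such that the function $\lambda\mapsto(\lambda-\tilde{\mathcal D})^{-1}\tilde f$, defined on the resolvent set of $\tilde{\mathcal D}$, has no analytic extension to any neighborhood of $i\xi_0$; and let $\sigma(f)$ (the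 circular spectrum) be the set of all $\lambda_0\in\mathbb C$ with $|\lambda_0|=1$ such that the function $\lambda\mapsto(\lambda-\tilde S(1))^{-1}\tilde f$, defined on the resolvent set of $\tilde S(1)$, has no analytic extension to any neighborhood of $\lambda_0$. Here an analytic extension to a neighborhood of a point is an analytic $\mathbb Y$-valued function on an open neighborhood $U$ of the point that agrees with the given function at all points of $U$ in the resolvent set. Then for every $f\in BUC(\mathbb R^+,\mathbb X)$ $$\sigma(f)=\overline{e^{i\cdot sp(f)}}=\overline{\{e^{i\xi}:\xi\in sp(f)\}},$$ where the bar denotes the closure in $\mathbb C$. -/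

import Mathlib

open scoped NNReal BoundedContinuousFunction Topology
open Filter

noncomputable section

namespace AsympSpectrum

variable (X : Type*) [NormedAddCommGroup X] [NormedSpace ℂ X]

/-- `BUC(ℝ⁺, X)`: the bounded uniformly continuous functions `[0, ∞) → X`, with the sup norm
(inherited from the space of bounded continuous functions). -/
def BUC : Submodule ℂ (ℝ≥0 →ᵇ X) where
  carrier := {f | UniformContinuous f}
  add_mem' := fun hf hg => UniformContinuous.add hf hg
  zero_mem' := uniformContinuous_const
  smul_mem' := fun c _ hf => UniformContinuous.const_smul hf c

/-- `C₀(ℝ⁺, X)`: the functions in `BUC(ℝ⁺, X)` that tend to `0` at infinity. -/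
def C0 : Submodule ℂ (BUC X) where
  carrier := {f | Tendsto (fun t : ℝ≥0 => ‖f.1 t‖) atTop (𝓝 0)}
  add_mem' := fun {f g} hf hg => by
    have h := Tendsto.add (tendsto_zero_iff_norm_tendsto_zero.2 hf)
      (tendsto_zero_iff_norm_tendsto_zero.2 hg)
    rw [add_zero] at h
    exact tendsto_zero_iff_norm_tendsto_zero.1 h
  zero_mem' := by simp
  smul_mem' := fun c f hf => by
    have h := Tendsto.const_smul (tendsto_zero_iff_norm_tendsto_zero.2 hf) c
    rw [smul_zero] at h
    exact tendsto_zero_iff_norm_tendsto_zero.1 h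

variable {X}

theorem mem_C0 {f : BUC X} : f ∈ C0 X ↔ Tendsto (fun t : ℝ≥0 => ‖f.1 t‖) atTop (𝓝 0) :=
  Iff.rfl

theorem norm_apply_le (f : BUC X) (t : ℝ≥0) : ‖f.1 t‖ ≤ ‖f‖ := f.1.norm_coe_le_norm t

variable (X)

instance isClosed_C0 : IsClosed (C0 X : Set (BUC X)) := by
  refine isClosed_of_closure_subset fun f hf => ?_
  rw [SetLike.mem_coe, mem_C0, Metric.tendsto_atTop]
  intro ε hε
  obtain ⟨g, hg, hfg⟩ := Metric.mem_closure_iff.1 hf (ε / 2) (half_pos hε)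
  obtain ⟨N, hN⟩ := Metric.tendsto_atTop.1 (mem_C0.1 hg) (ε / 2) (half_pos hε)
  refine ⟨N, fun t ht => ?_⟩
  have h1 := hN t ht
  have h2 : ‖f.1 t - g.1 t‖ ≤ ‖f - g‖ := norm_apply_le (f - g) t
  rw [dist_eq_norm] at hfg
  simp only [dist_zero_right, norm_norm] at h1 ⊢
  have h3 : ‖f.1 t‖ ≤ ‖f.1 t - g.1 t‖ + ‖g.1 t‖ := by
    simpa using norm_add_le (f.1 t - g.1 t) (g.1 t)
  linarith

/-- The quotient space `𝕐 = BUC(ℝ⁺, X) / C₀(ℝ⁺, X)` with the quotient norm. -/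
abbrev Y : Type _ := BUC X ⧸ C0 X

variable {X}

/-- The class `f̃` of `f` in `𝕐`. -/
def cls (f : BUC X) : Y X := (C0 X).mkQ f

/-! ### Translations -/

/-- The translate `s ↦ f (s + t)` of `f`. -/
def translate (t : ℝ≥0) (f : BUC X) : BUC X :=
  ⟨f.1.compContinuous ⟨fun s => s + t, by fun_prop⟩, by
    have h : UniformContinuous fun s : ℝ≥0 => s + t :=
      Isometry.uniformContinuous (Isometry.of_dist_eq fun a b => by simp [NNReal.dist_eq])
    have hf : UniformContinuous (f.1 : ℝ≥0 → X) := f.2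
    exact hf.comp h⟩

@[simp] theorem translate_apply (t : ℝ≥0) (f : BUC X) (s : ℝ≥0) :
    (translate t f).1 s = f.1 (s + t) := rfl

/-- The translation operator `S(t)` on `BUC(ℝ⁺, X)`, `t ≥ 0`. -/
def S (t : ℝ≥0) : BUC X →L[ℂ] BUC X :=
  LinearMap.mkContinuous
    { toFun := translate t
      map_add' := fun _ _ => rfl
      map_smul' := fun _ _ => rfl } 1 (fun f => by
      rw [one_mul]
      exact (BoundedContinuousFunction.norm_le (norm_nonneg f)).2
        fun s => norm_apply_le f (s + t))

@[simp] theorem S_apply (t : ℝ≥0) (f : BUC X) (s : ℝ≥0) : (S t f).1 s = f.1 (s + t) := rfl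

theorem S_mem_C0 (t : ℝ≥0) {f : BUC X} (hf : f ∈ C0 X) : S t f ∈ C0 X :=
  (mem_C0.1 hf).comp (tendsto_atTop_mono (fun _ => le_self_add) tendsto_id)

/-- The operator `S̃(t)` on `𝕐` induced by `S(t)`. -/
def Stilde (t : ℝ≥0) : Y X →L[ℂ] Y X :=
  (C0 X).liftQL ((C0 X).mkQL.comp (S t)) fun f hf => by
    rw [LinearMap.mem_ker]
    exact (Submodule.Quotient.mk_eq_zero (C0 X)).2 (S_mem_C0 t hf)

theorem Stilde_cls (t : ℝ≥0) (f : BUC X) : Stilde t (cls f) = cls (S t f) := rfl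

/-! ### Differentiation -/

/-- `u` is differentiable on `[0, ∞)` with derivative `v` (one-sided at the endpoint `0`). -/
def IsDerivOf (u v : BUC X) : Prop :=
  ∀ t : ℝ≥0, HasDerivWithinAt (fun s : ℝ => u.1 s.toNNReal) (v.1 t) (Set.Ici 0) (t : ℝ)

variable (X)

/-- The graph of the operator `𝒟 = d/dt` in `BUC(ℝ⁺, X)`, whose domain consists of the
differentiable `u ∈ BUC(ℝ⁺, X)` with `u' ∈ BUC(ℝ⁺, X)`. -/
def derivGraph : Submodule ℂ (BUC X × BUC X) where
  carrier := {p | IsDerivOf p.1 p.2}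
  add_mem' := fun hp hq t => (hp t).add (hq t)
  zero_mem' := fun t => hasDerivWithinAt_const (t : ℝ) (Set.Ici 0) (0 : X)
  smul_mem' := fun c _ hp t => (hp t).const_smul c

/-- The operator `𝒟 = d/dt` in `BUC(ℝ⁺, X)`. -/
def D : BUC X →ₗ.[ℂ] BUC X := (derivGraph X).toLinearPMap

/-- The operator `𝒟̃` in `𝕐`: its graph is the set of the pairs `(ũ, (𝒟u)~)`, `u ∈ D(𝒟)`. -/
def Dtilde : Y X →ₗ.[ℂ] Y X :=
  ((D X).graph.map ((C0 X).mkQ.prodMap (C0 X).mkQ)).toLinearPMap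

variable {X}

theorem D_graph : (D X).graph = derivGraph X := by
  refine Submodule.toLinearPMap_graph_eq _ ?_
  rintro ⟨u, v⟩ huv (rfl : u = 0)
  apply Subtype.ext
  ext t
  exact (uniqueDiffOn_Ici (0 : ℝ) (t : ℝ) t.2).eq_deriv _ (huv t)
    (hasDerivWithinAt_const (t : ℝ) (Set.Ici 0) (0 : X))

/-- If `u ∈ C₀` has a derivative in `BUC`, then this derivative belongs to `C₀`. -/
theorem deriv_mem_C0 {u v : BUC X} (huv : IsDerivOf u v) (hu : u ∈ C0 X) : v ∈ C0 X := by
  rw [mem_C0, Metric.tendsto_atTop]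
  intro ε hε
  obtain ⟨δ, hδ, hv⟩ := Metric.uniformContinuous_iff.1 v.2 (ε / 2) (half_pos hε)
  set h : ℝ := δ / 2 with hh
  have hpos : 0 < h := half_pos hδ
  obtain ⟨N, hN⟩ := Metric.tendsto_atTop.1 (mem_C0.1 hu) (ε * h / 8) (by positivity)
  refine ⟨N, fun t ht => ?_⟩
  have ht0 : (0 : ℝ) ≤ t := t.2
  have key := norm_image_sub_le_of_norm_deriv_le_segment' (a := (t : ℝ)) (b := t + h)
    (f := fun s : ℝ => u.1 s.toNNReal - (s - t) • v.1 t)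
    (f' := fun s : ℝ => v.1 s.toNNReal - (1 : ℝ) • v.1 t) (C := ε / 2)
    (fun s hs => by
      have hs0 : (0 : ℝ) ≤ s := ht0.trans hs.1
      have h1 := (huv s.toNNReal).mono (s := Set.Icc (t : ℝ) (t + h))
        fun r hr => ht0.trans hr.1
      rw [Real.coe_toNNReal s hs0] at h1
      exact h1.sub ((((hasDerivWithinAt_id s _).sub_const (t : ℝ))).smul_const (v.1 t)))
    (fun s hs => by
      have hs0 : (0 : ℝ) ≤ s := ht0.trans hs.1
      have h1 : dist s.toNNReal t < δ := by
        rw [NNReal.dist_eq, Real.coe_toNNReal s hs0, abs_of_nonneg (by linarith [hs.1])]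
        linarith [hs.2]
      have h2 := hv h1
      rw [dist_eq_norm] at h2
      rw [one_smul]
      exact h2.le)
    (t + h) ⟨by linarith, le_rfl⟩
  have hb : t ≤ ((t : ℝ) + h).toNNReal := NNReal.le_toNNReal_of_coe_le (by linarith)
  have n1 := hN t ht
  have n2 := hN _ (ht.trans hb)
  simp only [dist_zero_right, norm_norm, sub_self, zero_smul, sub_zero, add_sub_cancel_left,
    Real.toNNReal_coe] at n1 n2 key ⊢
  have e : h • v.1 t = u.1 ((t : ℝ) + h).toNNReal - u.1 t
      - (u.1 ((t : ℝ) + h).toNNReal - h • v.1 t - u.1 t) := by abel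
  have e2 : h * ‖v.1 t‖ = ‖h • v.1 t‖ := by rw [norm_smul, Real.norm_of_nonneg hpos.le]
  have e3 : h * ‖v.1 t‖ < h * ε := by
    rw [e2, e]
    have a1 := norm_sub_le (u.1 ((t : ℝ) + h).toNNReal - u.1 t)
      (u.1 ((t : ℝ) + h).toNNReal - h • v.1 t - u.1 t)
    have a2 := norm_sub_le (u.1 ((t : ℝ) + h).toNNReal) (u.1 t)
    nlinarith [mul_pos hε hpos]
  exact lt_of_mul_lt_mul_left e3 hpos.le

/-- `𝒟̃` is well defined as a single-valued operator. -/
theorem Dtilde_graph :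
    (Dtilde X).graph = (D X).graph.map ((C0 X).mkQ.prodMap (C0 X).mkQ) := by
  refine Submodule.toLinearPMap_graph_eq _ ?_
  rintro _ ⟨⟨u, v⟩, huv, rfl⟩ h0
  rw [D_graph] at huv
  exact (Submodule.Quotient.mk_eq_zero (C0 X)).2
    (deriv_mem_C0 huv ((Submodule.Quotient.mk_eq_zero (C0 X)).1 h0))

theorem mem_Dtilde_graph {y z : Y X} :
    (y, z) ∈ (Dtilde X).graph ↔ ∃ u v : BUC X, IsDerivOf u v ∧ cls u = y ∧ cls v = z := by
  rw [Dtilde_graph, D_graph]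
  constructor
  · rintro ⟨⟨u, v⟩, huv, h⟩
    exact ⟨u, v, huv, congrArg Prod.fst h, congrArg Prod.snd h⟩
  · rintro ⟨u, v, huv, rfl, rfl⟩
    exact ⟨(u, v), huv, rfl⟩

/-! ### Resolvents of unbounded operators -/

section Resolvent

variable {E : Type*} [NormedAddCommGroup E] [NormedSpace ℂ E]

/-- `R` is a bounded two-sided inverse of `z - A : D(A) → E`. -/
def IsResolventOf (A : E →ₗ.[ℂ] E) (z : ℂ) (R : E →L[ℂ] E) : Prop :=
  (∀ x : E, ∃ y : A.domain, (y : E) = R x ∧ z • (y : E) - A y = x) ∧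
    ∀ y : A.domain, R (z • (y : E) - A y) = y

/-- The resolvent set `ρ(A)` of the (unbounded) operator `A`. -/
def resolventSetPMap (A : E →ₗ.[ℂ] E) : Set ℂ := {z | ∃ R, IsResolventOf A z R}

open Classical in
/-- The resolvent `(z - A)⁻¹` for `z ∈ ρ(A)` (and `0` outside `ρ(A)`). -/
def resolventPMap (A : E →ₗ.[ℂ] E) (z : ℂ) : E →L[ℂ] E :=
  if h : ∃ R, IsResolventOf A z R then h.choose else 0

/-- The function `F`, given on the set `dom`, has an analytic extension to a neighborhood
of `z₀`: some analytic function on an open neighborhood `U` of `z₀` agrees with `F` on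
`U ∩ dom`. -/
def HasAnalyticExtensionAt (dom : Set ℂ) (F : ℂ → E) (z₀ : ℂ) : Prop :=
  ∃ (U : Set ℂ) (G : ℂ → E), IsOpen U ∧ z₀ ∈ U ∧ AnalyticOnNhd ℂ G U ∧
    Set.EqOn G F (U ∩ dom)

end Resolvent

/-! ### The two spectra of a function -/

/-- `f̂(λ) = (λ - 𝒟̃)⁻¹ f̃`, for `λ` in the resolvent set of `𝒟̃`. -/
def fhat (f : BUC X) (z : ℂ) : Y X := resolventPMap (Dtilde X) z (cls f)

/-- The spectrum `sp(f)`: the `ξ ∈ ℝ` such that `f̂` has no analytic extension to any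
neighborhood of `iξ`. -/
def sp (f : BUC X) : Set ℝ :=
  {ξ : ℝ | ¬ HasAnalyticExtensionAt (E := Y X) (resolventSetPMap (E := Y X) (Dtilde X)) (fhat f) (Complex.I * ξ)}

/-- The circular spectrum `σ(f)`: the points `z₀` of the unit circle such that
`λ ↦ R(λ, S̃(1)) f̃` has no analytic extension to any neighborhood of `z₀`. -/
def circularSpectrum (f : BUC X) : Set ℂ :=
  {z₀ | ‖z₀‖ = 1 ∧
    ¬ HasAnalyticExtensionAt (resolventSet ℂ (Stilde 1 : Y X →L[ℂ] Y X))
      (fun z => resolvent (Stilde 1 : Y X →L[ℂ] Y X) z (cls f)) z₀}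

end AsympSpectrum

end

/-! Modulo `C0`, translation becomes invertible, so T = `Stilde 1` is an invertible isometry of `Y`
and its spectrum lies on the unit circle. With B(z) = ∫₀¹ e^{z(1-s)} S̃(s) ds (`expAverage`) one has
(z - 𝒟̃) B(z) = e^z - T, and B(z) (z - 𝒟̃) = e^z - T on the domain. Hence 𝒟̃ has the resolvent B(z)
(e^z - T)⁻¹ off the imaginary axis.

Both resolvent sets are dense, so an analytic extension of the resolvent applied to x = f̃ is the
same as an analytic local solution u of (λ - T) u = x, respectively of (z - 𝒟̃) u = x. The unbounded
equation is rewritten with the bounded operator J = (1 - 𝒟̃)⁻¹ as (1 + (z - 1) J) u = J x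
(`pencil`).

One inclusion is direct: if G solves (λ - T) G = x near e^{iξ}, then B(z) G(e^z) solves (z - 𝒟̃) u =
x near iξ; and σ(f) is closed.

For the other, let c on the unit circle have distance at least ε from every e^{iξ}, ξ ∈ sp(f). On
the circle |w - c| = ε/2 take P = ∮ q(w)² R(w, T) dw, where q vanishes at the crossings with the
unit circle and so tames the resolvent there. The vector P x has local solutions for 𝒟̃ everywhere:
where |e^z - c| < ε by applying P to those of x, and where |e^z - c| ≥ ε because a Cauchy integral
solves (λ - T) u = P x outside the disc. They glue to an entire F with |Re z| ‖F(z)‖ ≤ ‖P x‖, which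
forces F = 0 (`eq_zero_of_re_mul_norm_le`) and P x = 0. The same Cauchy integral, divided by 2πi q²,
then solves (λ - T) u = x near c, so c ∉ σ(f). -/

noncomputable section

namespace AsympSpectrum

/-! ### Analytic local solutions, and a Liouville theorem for entire functions. -/

section LocalSolution

variable {E : Type*} [NormedAddCommGroup E] [NormedSpace ℂ E]

/-- The equation `L z u = c` has a solution `u` depending analytically on `z` near `z₀`. -/
def HasLocalSolution (L : ℂ → E →L[ℂ] E) (c : E) (z₀ : ℂ) : Prop :=
  ∃ (U : Set ℂ) (G : ℂ → E), IsOpen U ∧ z₀ ∈ U ∧ AnalyticOnNhd ℂ G U ∧ ∀ z ∈ U, L z (G z) = c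

/-- Two continuous functions that agree on the trace of a dense set on an open set agree on the
open set. -/
theorem eqOn_of_eqOn_inter_dense {F : Type*} [TopologicalSpace F] [T2Space F] {g h : ℂ → F}
    {U D : Set ℂ} (hU : IsOpen U) (hD : Dense D) (hg : ContinuousOn g U) (hh : ContinuousOn h U)
    (heq : Set.EqOn g h (U ∩ D)) : Set.EqOn g h U := by
  refine heq.of_subset_closure hg hh Set.inter_subset_left ?_
  exact hD.open_subset_closure_inter hU

/-- For a function `F` that solves a pencil of equations uniquely on a dense set, analytic
extensions are the same as analytic local solutions. -/
theorem hasAnalyticExtensionAt_iff {L : ℂ → E →L[ℂ] E} (hL : Continuous L) {c : E}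
    {dom : Set ℂ} (hdom : Dense dom) {F : ℂ → E} (hF : ∀ z ∈ dom, L z (F z) = c)
    (hinj : ∀ z ∈ dom, Function.Injective (L z)) (z₀ : ℂ) :
    HasAnalyticExtensionAt dom F z₀ ↔ HasLocalSolution L c z₀ := by
  constructor
  · rintro ⟨U, G, hU, hz, hG, hGF⟩
    refine ⟨U, G, hU, hz, hG, ?_⟩
    refine eqOn_of_eqOn_inter_dense (g := fun z => L z (G z)) (h := fun _ => c) hU hdom
      (hL.continuousOn.clm_apply hG.continuousOn) continuousOn_const fun z hz => ?_
    change L z (G z) = c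
    rw [hGF hz, hF z hz.2]
  · rintro ⟨U, G, hU, hz, hG, hLG⟩
    exact ⟨U, G, hU, hz, hG, fun z hz => hinj z hz.2 ((hLG z hz.1).trans (hF z hz.2).symm)⟩

/-- Local solutions are unique, so that local solutions everywhere define an entire solution. -/
theorem exists_entire_solution [CompleteSpace E] {L : ℂ → E →L[ℂ] E} {c : E} {D : Set ℂ}
    (hD : Dense D)
    (hinj : ∀ z ∈ D, Function.Injective (L z)) (h : ∀ z, HasLocalSolution L c z) :
    ∃ F : ℂ → E, Differentiable ℂ F ∧ ∀ z, L z (F z) = c := by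
  choose U G hU hmem hG hLG using h
  refine ⟨fun z => G z z, fun z => ?_, fun z => hLG z z (hmem z)⟩
  have key : ∀ w ∈ U z, G w w = G z w := fun w hw => by
    refine eqOn_of_eqOn_inter_dense (U := U w ∩ U z) ((hU w).inter (hU z)) hD
      ((hG w).continuousOn.mono Set.inter_subset_left)
      ((hG z).continuousOn.mono Set.inter_subset_right) (fun v hv => ?_) ⟨hmem w, hw⟩
    exact hinj v hv.2 ((hLG w v hv.1.1).trans (hLG z v hv.1.2).symm)
  refine ((hG z z (hmem z)).differentiableAt).congr_of_eventuallyEq ?_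
  filter_upwards [(hU z).mem_nhds (hmem z)] with w hw using key w hw

/-- Since r² = w w̄, the sum is w (w̄ + w). On the circle this multiplier offsets exactly a
singularity of the type 1 / |Re w|. -/
theorem norm_add_sq_of_norm_eq {w : ℂ} {r : ℝ} (hw : ‖w‖ = r) :
    ‖(r : ℂ) ^ 2 + w ^ 2‖ = 2 * r * |w.re| := by
  have h1 : (r : ℂ) ^ 2 = w * (starRingEnd ℂ) w := by
    rw [Complex.mul_conj, Complex.normSq_eq_norm_sq, hw]; push_cast; ring
  have h2 : (r : ℂ) ^ 2 + w ^ 2 = w * ((2 * w.re : ℝ) : ℂ) := by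
    rw [h1, ← Complex.add_conj]; ring
  rw [h2, norm_mul, hw, Complex.norm_real, Real.norm_eq_abs, abs_mul, abs_two]; ring

/-- An entire function bounded by `M / |Re z|` vanishes. -/
theorem eq_zero_of_re_mul_norm_le {F : ℂ → E} (hF : Differentiable ℂ F) {M : ℝ}
    (hM : ∀ z, |z.re| * ‖F z‖ ≤ M) (z : ℂ) : F z = 0 := by
  -- Maximum principle for (r² + w²) F(w) on the ball of radius r. The left side grows like r² and
  -- the right side like r, which forces F z = 0.
  have bound : ∀ r : ℝ, ‖z‖ < r → ‖(r : ℂ) ^ 2 + z ^ 2‖ * ‖F z‖ ≤ 2 * r * M := fun r hr => by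
    have hr0 : 0 < r := (norm_nonneg z).trans_lt hr
    have hd : Differentiable ℂ fun w : ℂ => ((r : ℂ) ^ 2 + w ^ 2) • F w := by fun_prop
    have := Complex.norm_le_of_forall_mem_frontier_norm_le (U := Metric.ball (0 : ℂ) r)
      (f := fun w : ℂ => ((r : ℂ) ^ 2 + w ^ 2) • F w) (C := 2 * r * M)
      Metric.isBounded_ball hd.diffContOnCl (fun w hw => by
        rw [frontier_ball _ hr0.ne', mem_sphere_zero_iff_norm] at hw
        rw [norm_smul, norm_add_sq_of_norm_eq hw, mul_assoc]
        exact mul_le_mul_of_nonneg_left (hM w) (by positivity))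
      (subset_closure (by simpa using hr) : z ∈ closure (Metric.ball (0 : ℂ) r))
    rwa [norm_smul] at this
  by_contra hne
  have hpos : 0 < ‖F z‖ := norm_pos_iff.2 hne
  have hM0 : 0 ≤ M := (by positivity : 0 ≤ |z.re| * ‖F z‖).trans (hM z)
  -- r ≥ 2‖z‖ gives r² - ‖z‖² ≥ 3r²/4, and r ‖F z‖ > 4M then contradicts the bound.
  set r : ℝ := 2 * ‖z‖ + 4 * M / ‖F z‖ + 1 with hr
  have hdiv : 0 ≤ 4 * M / ‖F z‖ := by positivity
  have hz0 := norm_nonneg z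
  have h1 := bound r (by linarith)
  have h2 : r ^ 2 - ‖z‖ ^ 2 ≤ ‖(r : ℂ) ^ 2 + z ^ 2‖ := by
    have := norm_sub_le_norm_add ((r : ℂ) ^ 2) (z ^ 2)
    rw [norm_pow, norm_pow, Complex.norm_real, Real.norm_of_nonneg (by linarith)] at this
    exact this
  have h3 : (r ^ 2 - ‖z‖ ^ 2) * ‖F z‖ ≤ 2 * r * M :=
    (mul_le_mul_of_nonneg_right h2 hpos.le).trans h1
  have h4 : r ^ 2 * (3 / 4) ≤ r ^ 2 - ‖z‖ ^ 2 := by nlinarith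
  have h5 : r * ‖F z‖ = 2 * ‖z‖ * ‖F z‖ + 4 * M + ‖F z‖ := by
    rw [hr]; field_simp
  have h6 : r ^ 2 * (3 / 4) * ‖F z‖ ≤ 2 * r * M :=
    (mul_le_mul_of_nonneg_right h4 hpos.le).trans h3
  have hrp : 0 < r := by linarith
  have h7 : r * (3 / 4 * (r * ‖F z‖)) ≤ r * (2 * M) := by nlinarith
  have h8 := le_of_mul_le_mul_left h7 hrp
  have : 0 ≤ ‖z‖ * ‖F z‖ := by positivity
  linarith

end LocalSolution

/-! ### Cauchy integrals over a circle. -/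

section CircleIntegral

variable {E : Type*} [NormedAddCommGroup E] [NormedSpace ℂ E]

/-- The Cauchy integral of a continuous function is analytic off the circle. -/
theorem differentiableAt_cauchy_integral [CompleteSpace E] {k : ℂ → E} {c : ℂ} {r : ℝ} (hr : 0 ≤ r)
    (hk : ContinuousOn k (Metric.sphere c r)) {l : ℂ} (hl : l ∉ Metric.sphere c r) :
    DifferentiableAt ℂ (fun l => ∮ w in C(c, r), (w - l)⁻¹ • k w) l := by
  obtain ⟨ε, hε, hball⟩ := Metric.isOpen_iff.1 (Metric.isClosed_sphere (x := c) (ε := r)).isOpen_compl l hl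
  have hkc : Continuous fun θ => k (circleMap c r θ) :=
    hk.comp_continuous (continuous_circleMap c r) fun θ => circleMap_mem_sphere c hr θ
  have hne : ∀ z ∈ Metric.ball l ε, ∀ θ, circleMap c r θ - z ≠ 0 := fun z hz θ h0 =>
    hball hz (by rw [← sub_eq_zero.1 h0]; exact circleMap_mem_sphere c hr θ)
  -- Halving the radius keeps z at distance at least ε/2 from the circle, uniformly in z; this
  -- dominates the differentiated integrand.
  have hsep : ∀ z ∈ Metric.ball l (ε / 2), ∀ θ, ε / 2 ≤ ‖circleMap c r θ - z‖ := fun z hz θ => by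
    by_contra! h
    have : circleMap c r θ ∈ Metric.ball l ε := by
      rw [Metric.mem_ball]
      have := dist_triangle (circleMap c r θ) z l
      rw [dist_eq_norm (circleMap c r θ) z] at this
      rw [Metric.mem_ball] at hz
      linarith
    exact hball this (circleMap_mem_sphere c hr θ)
  have hd : Continuous (deriv (circleMap c r)) := by
    rw [funext (deriv_circleMap c r)]
    exact (continuous_circleMap 0 r).mul continuous_const
  have hcont : ∀ n : ℕ, ∀ z ∈ Metric.ball l ε, Continuous fun θ =>
      deriv (circleMap c r) θ • ((circleMap c r θ - z)⁻¹ ^ n • k (circleMap c r θ)) :=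
    fun n z hz => hd.smul (((((continuous_circleMap c r).sub continuous_const).inv₀
      (hne z hz)).pow n).smul hkc)
  have hsub := Metric.ball_subset_ball (x := l) (half_le_self hε.le)
  refine (intervalIntegral.hasDerivAt_integral_of_dominated_loc_of_deriv_le (μ := MeasureTheory.volume) (𝕜 := ℂ)
    (s := Metric.ball l (ε / 2)) (x₀ := l) (a := 0) (b := 2 * Real.pi)
    (F' := fun z θ => deriv (circleMap c r) θ • ((circleMap c r θ - z)⁻¹ ^ 2 • k (circleMap c r θ)))
    (bound := fun θ => ‖deriv (circleMap c r) θ‖ * ((ε / 2)⁻¹ ^ 2 * ‖k (circleMap c r θ)‖))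
    (Metric.ball_mem_nhds l (half_pos hε)) ?_ ?_ ?_ ?_ ?_ ?_).2.differentiableAt
  · filter_upwards [Metric.ball_mem_nhds l hε] with z hz
    simpa using (hcont 1 z hz).aestronglyMeasurable
  · simpa using (hcont 1 l (Metric.mem_ball_self hε)).intervalIntegrable 0 (2 * Real.pi)
  · exact (hcont 2 l (Metric.mem_ball_self hε)).aestronglyMeasurable
  · refine MeasureTheory.ae_of_all _ fun θ _ z hz => ?_
    rw [norm_smul, norm_smul, norm_pow, norm_inv]
    have := hsep z hz θ
    gcongr
  · exact (hd.norm.mul (continuous_const.mul hkc.norm)).intervalIntegrable _ _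
  · refine MeasureTheory.ae_of_all _ fun θ _ z hz => ?_
    have h1 : HasDerivAt (fun z => circleMap c r θ - z) (-1) z := by
      simpa using (hasDerivAt_id z).const_sub (circleMap c r θ)
    have h2 := h1.inv (hne z (hsub hz) θ)
    have h3 : - -1 / (circleMap c r θ - z) ^ 2 = (circleMap c r θ - z)⁻¹ ^ 2 := by
      rw [neg_neg, one_div, inv_pow]
    rw [h3] at h2
    exact (h2.smul_const (k (circleMap c r θ))).const_smul _

end CircleIntegral

/-! ### Resolvent growth of an isometry near the unit circle. -/

section Isometry

variable {E : Type*} [NormedAddCommGroup E] [NormedSpace ℂ E] {T : E →L[ℂ] E}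

theorem abs_norm_sub_one_mul_norm_le (hT : ∀ u, ‖T u‖ = ‖u‖) (l : ℂ) (u : E) :
    |‖l‖ - 1| * ‖u‖ ≤ ‖(algebraMap ℂ (E →L[ℂ] E) l - T) u‖ := by
  have h : (algebraMap ℂ (E →L[ℂ] E) l - T) u = l • u - T u := by
    simp [Algebra.algebraMap_eq_smul_one]
  have h2 := abs_norm_sub_norm_le (l • u) (T u)
  rw [norm_smul, hT] at h2
  rw [h]
  refine le_trans (le_of_eq ?_) h2
  rw [← abs_of_nonneg (norm_nonneg u), ← abs_mul, sub_mul, one_mul, abs_of_nonneg (norm_nonneg u)]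

theorem sub_mul_resolvent {l : ℂ} (hl : l ∈ resolventSet ℂ T) :
    (algebraMap ℂ (E →L[ℂ] E) l - T) * resolvent T l = 1 :=
  Ring.mul_inverse_cancel _ hl

theorem norm_resolvent_le (hT : ∀ u, ‖T u‖ = ‖u‖) (hρ : ∀ l : ℂ, ‖l‖ ≠ 1 → l ∈ resolventSet ℂ T)
    {l : ℂ} (hl : ‖l‖ ≠ 1) : ‖resolvent T l‖ ≤ |‖l‖ - 1|⁻¹ := by
  refine ContinuousLinearMap.opNorm_le_bound _ (by positivity) fun v => ?_
  have h := abs_norm_sub_one_mul_norm_le hT l (resolvent T l v)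
  have h2 : (algebraMap ℂ (E →L[ℂ] E) l - T) (resolvent T l v) = v := by
    have := congrArg (fun A : E →L[ℂ] E => A v) (sub_mul_resolvent (hρ l hl))
    simpa using this
  rw [h2] at h
  have : 0 < |‖l‖ - 1| := abs_pos.2 (sub_ne_zero.2 hl)
  rwa [inv_mul_eq_div, le_div_iff₀ this, mul_comm]

/-- The quadratic polynomial vanishing where the circle `|w - c| = r` meets the unit circle. -/
def circleQuad (c : ℂ) (r : ℝ) (w : ℂ) : ℂ := w ^ 2 - (2 - r ^ 2) * c * w + c ^ 2

theorem continuous_circleQuad (c : ℂ) (r : ℝ) : Continuous (circleQuad c r) := by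
  unfold circleQuad; fun_prop

/-- On the circle r² = (w - c)(w̄ - c̄); inserting this and c c̄ = 1 factors the quadratic as c (w -
c)(|w|² - 1). -/
theorem norm_circleQuad {c w : ℂ} {r : ℝ} (hc : ‖c‖ = 1) (hw : ‖w - c‖ = r) :
    ‖circleQuad c r w‖ = r * ((‖w‖ + 1) * |‖w‖ - 1|) := by
  have h1 : (r : ℂ) ^ 2 = (w - c) * ((starRingEnd ℂ) w - (starRingEnd ℂ) c) := by
    rw [← map_sub, Complex.mul_conj, Complex.normSq_eq_norm_sq, hw]; push_cast; ring
  have h2 : c * (starRingEnd ℂ) c = 1 := by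
    rw [Complex.mul_conj, Complex.normSq_eq_norm_sq, hc]; simp
  have h3 : w * (starRingEnd ℂ) w = ((‖w‖ ^ 2 : ℝ) : ℂ) := by
    rw [Complex.mul_conj, Complex.normSq_eq_norm_sq]
  have h4 : circleQuad c r w = c * ((w - c) * ((‖w‖ ^ 2 - 1 : ℝ) : ℂ)) := by
    push_cast
    rw [Complex.ofReal_pow] at h3
    rw [← h3, circleQuad, h1]
    linear_combination (-(w - c) * w) * h2
  rw [h4, norm_mul, norm_mul, hc, hw, one_mul, Complex.norm_real, Real.norm_eq_abs,
    show ‖w‖ ^ 2 - 1 = (‖w‖ + 1) * (‖w‖ - 1) by ring, abs_mul,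
    abs_of_nonneg (by positivity : 0 ≤ ‖w‖ + 1)]

end Isometry

section CircleIntegral

theorem circleIntegral_clm_comp {F G : Type*} [NormedAddCommGroup F] [NormedSpace ℂ F]
    [CompleteSpace F] [NormedAddCommGroup G] [NormedSpace ℂ G] [CompleteSpace G]
    (A : F →L[ℂ] G) {k : ℂ → F} {c : ℂ} {r : ℝ} (hk : CircleIntegrable k c r) :
    (∮ w in C(c, r), A (k w)) = A (∮ w in C(c, r), k w) := by
  simp only [circleIntegral, ← map_smul]
  exact A.intervalIntegral_comp_comm hk.out

end CircleIntegral

/-! ### The damped spectral projection of a disc centred on the unit circle. -/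

section Projection

variable {E : Type*} [NormedAddCommGroup E] [NormedSpace ℂ E] {T : E →L[ℂ] E} {c : ℂ} {r : ℝ}

/-- The resolvent of `T`, damped where the circle `|w - c| = r` meets the unit circle. -/
def dampedResolvent (T : E →L[ℂ] E) (c : ℂ) (r : ℝ) (w : ℂ) : E →L[ℂ] E :=
  circleQuad c r w ^ 2 • resolvent T w

/-- A damped version of the spectral projection of `T` belonging to the disc `|w - c| < r`. -/
def dampedProjection (T : E →L[ℂ] E) (c : ℂ) (r : ℝ) : E →L[ℂ] E :=
  ∮ w in C(c, r), dampedResolvent T c r w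

theorem circleQuad_eq_zero (hc : ‖c‖ = 1) {w : ℂ} (hw : ‖w - c‖ = r) (h1 : ‖w‖ = 1) :
    circleQuad c r w = 0 := by
  rw [← norm_eq_zero, norm_circleQuad hc hw, h1]; simp

/-- One factor `circleQuad` cancels the growth of the resolvent; the second survives and makes the
integrand tend to 0 at the crossings. This is why the square is taken. -/
theorem norm_dampedResolvent_le (hT : ∀ u, ‖T u‖ = ‖u‖)
    (hρ : ∀ l : ℂ, ‖l‖ ≠ 1 → l ∈ resolventSet ℂ T) (hc : ‖c‖ = 1) {w : ℂ}
    (hw : ‖w - c‖ = r) :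
    ‖dampedResolvent T c r w‖ ≤ ‖circleQuad c r w‖ * (r * (‖w‖ + 1)) := by
  by_cases h1 : ‖w‖ = 1
  · simp [dampedResolvent, circleQuad_eq_zero hc hw h1]
  · have hpos : 0 < |‖w‖ - 1| := abs_pos.2 (sub_ne_zero.2 h1)
    rw [dampedResolvent, norm_smul, norm_pow, sq, mul_assoc]
    refine mul_le_mul_of_nonneg_left ?_ (norm_nonneg _)
    calc ‖circleQuad c r w‖ * ‖resolvent T w‖
        ≤ ‖circleQuad c r w‖ * |‖w‖ - 1|⁻¹ :=
          mul_le_mul_of_nonneg_left (norm_resolvent_le hT hρ h1) (norm_nonneg _)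
      _ = r * (‖w‖ + 1) := by rw [norm_circleQuad hc hw]; field_simp

/-- At a crossing both sides are 0, whatever value `resolvent T w` has there. -/
theorem sub_mul_dampedResolvent (hρ : ∀ l : ℂ, ‖l‖ ≠ 1 → l ∈ resolventSet ℂ T) (hc : ‖c‖ = 1)
    {w : ℂ} (hw : ‖w - c‖ = r) :
    (algebraMap ℂ (E →L[ℂ] E) w - T) * dampedResolvent T c r w =
      circleQuad c r w ^ 2 • (1 : E →L[ℂ] E) := by
  by_cases h1 : ‖w‖ = 1
  · simp [dampedResolvent, circleQuad_eq_zero hc hw h1]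
  · rw [dampedResolvent, mul_smul_comm, sub_mul_resolvent (hρ w h1)]

theorem commute_resolvent {J : E →L[ℂ] E} (hJ : Commute J T) (w : ℂ) :
    Commute J (resolvent T w) := by
  have h : Commute J (algebraMap ℂ (E →L[ℂ] E) w - T) :=
    Commute.sub_right (Algebra.commutes w J).symm hJ
  by_cases hw : IsUnit (algebraMap ℂ (E →L[ℂ] E) w - T)
  · obtain ⟨u, hu⟩ := hw
    rw [← hu] at h
    rw [resolvent, ← hu, Ring.inverse_unit]
    exact h.units_inv_right
  · rw [resolvent, Ring.inverse_non_unit _ hw]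
    exact Commute.zero_right J

variable [CompleteSpace E]

theorem continuousOn_dampedResolvent (hT : ∀ u, ‖T u‖ = ‖u‖)
    (hρ : ∀ l : ℂ, ‖l‖ ≠ 1 → l ∈ resolventSet ℂ T) (hc : ‖c‖ = 1) :
    ContinuousOn (dampedResolvent T c r) (Metric.sphere c r) := by
  intro w hw
  rw [mem_sphere_iff_norm] at hw
  by_cases h1 : ‖w‖ = 1
  · have h0 : dampedResolvent T c r w = 0 := by
      simp [dampedResolvent, circleQuad_eq_zero hc hw h1]
    rw [ContinuousWithinAt, h0]
    refine squeeze_zero_norm' (a := fun v => ‖circleQuad c r v‖ * (r * (‖v‖ + 1))) ?_ ?_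
    · filter_upwards [self_mem_nhdsWithin] with v hv
      exact norm_dampedResolvent_le hT hρ hc (mem_sphere_iff_norm.1 hv)
    · have hcont : Continuous fun v => ‖circleQuad c r v‖ * (r * (‖v‖ + 1)) := by
        have := continuous_circleQuad c r
        fun_prop
      have h2 := (hcont.tendsto w).mono_left (nhdsWithin_le_nhds (s := Metric.sphere c r))
      simpa [circleQuad_eq_zero hc hw h1] using h2
  · exact (((continuous_circleQuad c r).pow 2).continuousAt.smul
      (spectrum.hasDerivAt_resolvent_const_left (hρ w h1)).continuousAt).continuousWithinAt

theorem commute_dampedProjection (hT : ∀ u, ‖T u‖ = ‖u‖)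
    (hρ : ∀ l : ℂ, ‖l‖ ≠ 1 → l ∈ resolventSet ℂ T) (hc : ‖c‖ = 1) (hr : 0 ≤ r)
    {J : E →L[ℂ] E} (hJ : Commute J T) : Commute J (dampedProjection T c r) := by
  have hint := (continuousOn_dampedResolvent (r := r) hT hρ hc).circleIntegrable hr
  have h1 := circleIntegral_clm_comp (ContinuousLinearMap.mul ℂ (E →L[ℂ] E) J) hint
  have h2 := circleIntegral_clm_comp ((ContinuousLinearMap.mul ℂ (E →L[ℂ] E)).flip J) hint
  rw [Commute, SemiconjBy, dampedProjection]
  simp only [ContinuousLinearMap.mul_apply', ContinuousLinearMap.flip_apply] at h1 h2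
  rw [← h1, ← h2]
  congr 1
  funext w
  rw [dampedResolvent, mul_smul_comm, smul_mul_assoc, (commute_resolvent hJ w).eq]

/-- Writing l - T = (w - T) - (w - l) splits the integrand into q(w)² / (w - l) minus the damped
resolvent. The scalar integral is 0 for l outside the disc and 2πi q(l)² inside. -/
theorem sub_mul_cauchy_integral (hT : ∀ u, ‖T u‖ = ‖u‖)
    (hρ : ∀ l : ℂ, ‖l‖ ≠ 1 → l ∈ resolventSet ℂ T) (hc : ‖c‖ = 1) (hr : 0 ≤ r) {l : ℂ}
    (hl : l ∉ Metric.sphere c r) :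
    (algebraMap ℂ (E →L[ℂ] E) l - T) *
        (∮ w in C(c, r), (w - l)⁻¹ • dampedResolvent T c r w) =
      (∮ w in C(c, r), (w - l)⁻¹ • circleQuad c r w ^ 2) • (1 : E →L[ℂ] E)
        - dampedProjection T c r := by
  have hK := continuousOn_dampedResolvent (r := r) hT hρ hc
  have hinv : ContinuousOn (fun w => (w - l)⁻¹) (Metric.sphere c r) :=
    (continuousOn_id.sub continuousOn_const).inv₀ fun w hw h0 => hl (by
      have h1 : w = l := sub_eq_zero.1 h0
      rwa [← h1])
  have hq := hinv.smul ((continuous_circleQuad c r).pow 2).continuousOn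
  have h1 := circleIntegral_clm_comp
    (ContinuousLinearMap.mul ℂ (E →L[ℂ] E) (algebraMap ℂ (E →L[ℂ] E) l - T))
    ((hinv.smul hK).circleIntegrable hr)
  simp only [ContinuousLinearMap.mul_apply', Pi.smul_apply'] at h1
  have hq1 : CircleIntegrable (fun w => ((w - l)⁻¹ • circleQuad c r w ^ 2) • (1 : E →L[ℂ] E)) c r :=
    (hq.smul continuousOn_const).circleIntegrable hr
  have h2 := circleIntegral.integral_smul_const (fun w => (w - l)⁻¹ • circleQuad c r w ^ 2)
    (1 : E →L[ℂ] E) c r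
  refine h1.symm.trans ?_
  rw [dampedProjection, ← h2, ← circleIntegral.integral_sub
    hq1 (hK.circleIntegrable hr)]
  refine circleIntegral.integral_congr hr fun w hw => ?_
  have hne : w - l ≠ 0 := fun h0 => hl (by rwa [← sub_eq_zero.1 h0])
  have e : algebraMap ℂ (E →L[ℂ] E) l - T =
      (algebraMap ℂ (E →L[ℂ] E) w - T) - (w - l) • (1 : E →L[ℂ] E) := by
    rw [Algebra.algebraMap_eq_smul_one, Algebra.algebraMap_eq_smul_one, sub_smul]; abel
  change (algebraMap ℂ (E →L[ℂ] E) l - T) * ((w - l)⁻¹ • dampedResolvent T c r w) =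
    ((w - l)⁻¹ • circleQuad c r w ^ 2) • (1 : E →L[ℂ] E) - dampedResolvent T c r w
  rw [mul_smul_comm, e, sub_mul, sub_mul_dampedResolvent hρ hc (mem_sphere_iff_norm.1 hw),
    smul_sub, smul_mul_assoc, one_mul, smul_smul, smul_smul, inv_mul_cancel₀ hne, one_smul,
    smul_eq_mul]

/-- Outside the disc, `dampedProjection T c r x` has local solutions. -/
theorem hasLocalSolution_dampedProjection (hT : ∀ u, ‖T u‖ = ‖u‖)
    (hρ : ∀ l : ℂ, ‖l‖ ≠ 1 → l ∈ resolventSet ℂ T) (hc : ‖c‖ = 1) (hr : 0 ≤ r) (x : E) {l : ℂ}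
    (hl : r < ‖l - c‖) :
    HasLocalSolution (fun z => algebraMap ℂ (E →L[ℂ] E) z - T) (dampedProjection T c r x) l := by
  set H : ℂ → E →L[ℂ] E := fun l => ∮ w in C(c, r), (w - l)⁻¹ • dampedResolvent T c r w with hH
  have hU : IsOpen (Metric.closedBall c r)ᶜ := Metric.isClosed_closedBall.isOpen_compl
  have hns : ∀ z ∈ (Metric.closedBall c r)ᶜ, z ∉ Metric.sphere c r :=
    fun z hz h => hz (Metric.sphere_subset_closedBall h)
  refine ⟨(Metric.closedBall c r)ᶜ, fun z => -(H z x), hU, ?_, ?_, fun z hz => ?_⟩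
  · simpa [dist_eq_norm] using hl
  · refine DifferentiableOn.analyticOnNhd (fun z hz => ?_) hU
    have := differentiableAt_cauchy_integral hr (continuousOn_dampedResolvent hT hρ hc)
      (hns z hz)
    exact ((this.clm_apply (differentiableAt_const x)).neg).differentiableWithinAt
  · have h1 := sub_mul_cauchy_integral hT hρ hc hr (hns z hz)
    have h2 : (∮ w in C(c, r), (w - z)⁻¹ • circleQuad c r w ^ 2) = 0 := by
      refine DiffContOnCl.circleIntegral_eq_zero hr (DifferentiableOn.diffContOnCl ?_)
      refine DifferentiableOn.mono (fun w hw => ?_) Metric.closure_ball_subset_closedBall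
      have hne : w - z ≠ 0 := fun h0 => hz (by rwa [← sub_eq_zero.1 h0])
      have hd : DifferentiableAt ℂ (circleQuad c r) w := by unfold circleQuad; fun_prop
      exact (((differentiableAt_id.sub_const z).inv hne).smul (hd.pow 2)).differentiableWithinAt
    rw [h2, zero_smul, zero_sub] at h1
    have h3 := congrArg (fun A : E →L[ℂ] E => A x) h1
    rw [map_neg]
    exact (congrArg Neg.neg h3).trans (neg_neg _)

/-- If `dampedProjection T c r x = 0`, then `x` has a local solution at the centre of the disc. -/
theorem hasLocalSolution_of_dampedProjection_eq_zero (hT : ∀ u, ‖T u‖ = ‖u‖)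
    (hρ : ∀ l : ℂ, ‖l‖ ≠ 1 → l ∈ resolventSet ℂ T) (hc : ‖c‖ = 1) (hr : 0 < r) {x : E}
    (hx : dampedProjection T c r x = 0) :
    HasLocalSolution (fun z => algebraMap ℂ (E →L[ℂ] E) z - T) x c := by
  set H : ℂ → E →L[ℂ] E := fun l => ∮ w in C(c, r), (w - l)⁻¹ • dampedResolvent T c r w with hH
  have hdq : Differentiable ℂ (circleQuad c r) := by unfold circleQuad; fun_prop
  -- For r > 2 the quadratic has a zero inside the disc, so its zeros are removed. At the centre its
  -- value is r² c² ≠ 0.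
  set U : Set ℂ := Metric.ball c r ∩ {z | circleQuad c r z ≠ 0} with hUdef
  have hU : IsOpen U := Metric.isOpen_ball.inter
    (isOpen_ne_fun (continuous_circleQuad c r) continuous_const)
  have hns : ∀ z ∈ Metric.ball c r, z ∉ Metric.sphere c r :=
    fun z hz h => (Metric.mem_ball.1 hz).ne (Metric.mem_sphere.1 h)
  have hpi : (2 * Real.pi * Complex.I : ℂ) ≠ 0 := Complex.two_pi_I_ne_zero
  refine ⟨U, fun z => (2 * Real.pi * Complex.I * circleQuad c r z ^ 2)⁻¹ • H z x, hU,
    ⟨Metric.mem_ball_self hr, ?_⟩, ?_, fun z hz => ?_⟩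
  · have hc0 : c ≠ 0 := norm_ne_zero_iff.1 (by rw [hc]; exact one_ne_zero)
    have : circleQuad c r c = r ^ 2 * c ^ 2 := by unfold circleQuad; ring
    have hr0 : (r : ℂ) ≠ 0 := Complex.ofReal_ne_zero.2 hr.ne'
    change circleQuad c r c ≠ 0
    rw [this]; positivity
  · refine DifferentiableOn.analyticOnNhd (fun z hz => ?_) hU
    have h1 := differentiableAt_cauchy_integral hr.le
      (continuousOn_dampedResolvent hT hρ hc) (hns z hz.1)
    have h2 : DifferentiableAt ℂ
        (fun z => (2 * Real.pi * Complex.I * circleQuad c r z ^ 2)⁻¹) z :=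
      (((hdq z).pow 2).const_mul _).inv (mul_ne_zero hpi (pow_ne_zero 2 hz.2))
    exact (h2.smul (h1.clm_apply (differentiableAt_const x))).differentiableWithinAt
  · have h1 := sub_mul_cauchy_integral hT hρ hc hr.le (hns z hz.1)
    have h2 : (∮ w in C(c, r), (w - z)⁻¹ • circleQuad c r w ^ 2) =
        (2 * Real.pi * Complex.I : ℂ) • circleQuad c r z ^ 2 :=
      ((hdq.pow 2).diffContOnCl).circleIntegral_sub_inv_smul hz.1
    have h3 := congrArg (fun A : E →L[ℂ] E => A x) h1
    have h4 : (algebraMap ℂ (E →L[ℂ] E) z - T) (H z x) =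
        (2 * Real.pi * Complex.I * circleQuad c r z ^ 2) • x := by
      refine h3.trans ?_
      change (∮ w in C(c, r), (w - z)⁻¹ • circleQuad c r w ^ 2) • x - dampedProjection T c r x = _
      rw [hx, sub_zero, h2, smul_eq_mul]
    change (algebraMap ℂ (E →L[ℂ] E) z - T) (_ • H z x) = x
    rw [map_smul, h4, smul_smul, inv_mul_cancel₀ (mul_ne_zero hpi (pow_ne_zero 2 hz.2)), one_smul]

end Projection

/-! ### The abstract local spectral mapping theorem. -/

section SpectralMapping

variable {E : Type*} [NormedAddCommGroup E] [NormedSpace ℂ E]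
  {T J : E →L[ℂ] E} {B : ℂ → E →L[ℂ] E}

/-- The pencil equivalent to `z - A` when `J = (1 - A)⁻¹`: the equation `(z - A) u = y` means
`pencil J z u = J y`. -/
def pencil (J : E →L[ℂ] E) (z : ℂ) : E →L[ℂ] E := 1 + (z - 1) • J

/-- The factorisation (z - A) B(z) = e^z - T turns a solution G near e^{z₀} into B(z) G(e^z) near
z₀. -/
theorem hasLocalSolution_pencil [CompleteSpace E] (hB : Differentiable ℂ B)
    (hBT : ∀ z, pencil J z * B z = J * (algebraMap ℂ (E →L[ℂ] E) (Complex.exp z) - T))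
    {x : E} {z₀ : ℂ}
    (h : HasLocalSolution (fun z => algebraMap ℂ (E →L[ℂ] E) z - T) x (Complex.exp z₀)) :
    HasLocalSolution (pencil J) (J x) z₀ := by
  obtain ⟨U, G, hU, hmem, hG, hTG⟩ := h
  have hV : IsOpen (Complex.exp ⁻¹' U) := hU.preimage Complex.continuous_exp
  refine ⟨Complex.exp ⁻¹' U, fun z => B z (G (Complex.exp z)), hV, hmem, ?_, fun z hz => ?_⟩
  · refine DifferentiableOn.analyticOnNhd (fun z hz => ?_) hV
    exact ((hB z).clm_apply (((hG _ hz).differentiableAt).comp z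
      Complex.differentiableAt_exp)).differentiableWithinAt
  · have := congrArg (fun A : E →L[ℂ] E => A (G (Complex.exp z))) (hBT z)
    refine this.trans ?_
    change J ((algebraMap ℂ (E →L[ℂ] E) (Complex.exp z) - T) (G (Complex.exp z))) = J x
    rw [hTG _ hz]

theorem dense_re_ne_zero : Dense {z : ℂ | z.re ≠ 0} := by
  have h : {z : ℂ | z.re ≠ 0} = Complex.re ⁻¹' ({0}ᶜ : Set ℝ) := rfl
  rw [h]
  exact (dense_compl_singleton (0 : ℝ)).preimage Complex.isOpenMap_re

theorem dense_norm_ne_one : Dense {z : ℂ | ‖z‖ ≠ 1} := by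
  have h : {z : ℂ | ‖z‖ ≠ 1} = (Metric.sphere (0 : ℂ) 1)ᶜ := by ext; simp
  rw [h, ← interior_eq_empty_iff_dense_compl, interior_sphere _ one_ne_zero]

theorem hasLocalSolution_of_mem_resolventSet [CompleteSpace E] {l : ℂ} (hl : l ∈ resolventSet ℂ T) (x : E) :
    HasLocalSolution (fun z => algebraMap ℂ (E →L[ℂ] E) z - T) x l := by
  refine ⟨resolventSet ℂ T, fun z => resolvent T z x, spectrum.isOpen_resolventSet T, hl, ?_,
    fun z hz => congrArg (fun A : E →L[ℂ] E => A x) (sub_mul_resolvent hz)⟩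
  refine DifferentiableOn.analyticOnNhd (fun z hz => ?_) (spectrum.isOpen_resolventSet T)
  exact ((spectrum.hasDerivAt_resolvent_const_left hz).differentiableAt.clm_apply
    (differentiableAt_const x)).differentiableWithinAt

theorem pencil_injective
    (hdiss : ∀ z u y, pencil J z u = J y → |z.re| * ‖u‖ ≤ ‖y‖) {z : ℂ} (hz : z.re ≠ 0) :
    Function.Injective (pencil J z) := by
  refine (injective_iff_map_eq_zero _).2 fun u hu => ?_
  have h := hdiss z u 0 (by rw [hu, map_zero])
  rw [norm_zero] at h
  have hpos : 0 < |z.re| := abs_pos.2 hz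
  exact norm_le_zero_iff.1 (nonpos_of_mul_nonpos_right h hpos)

/-- A vector with local solutions everywhere vanishes. -/
theorem eq_zero_of_forall_hasLocalSolution [CompleteSpace E] (hJ : Function.Injective J)
    (hdiss : ∀ z u y, pencil J z u = J y → |z.re| * ‖u‖ ≤ ‖y‖) {y : E}
    (h : ∀ z, HasLocalSolution (pencil J) (J y) z) : y = 0 := by
  obtain ⟨F, hF, hsol⟩ := exists_entire_solution dense_re_ne_zero
    (fun z hz => pencil_injective hdiss hz) h
  have h0 := eq_zero_of_re_mul_norm_le hF (M := ‖y‖) (fun z => hdiss z _ y (hsol z)) 0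
  have h1 := hsol 0
  rw [h0, map_zero] at h1
  exact hJ (by rw [← h1, map_zero])

/-- The local weak spectral mapping theorem for an invertible isometry embedded in a group. -/
theorem localSpectrum_eq_closure [CompleteSpace E] (hT : ∀ u, ‖T u‖ = ‖u‖)
    (hρ : ∀ l : ℂ, ‖l‖ ≠ 1 → l ∈ resolventSet ℂ T) (hJ : Function.Injective J)
    (hJT : Commute J T) (hdiss : ∀ z u y, pencil J z u = J y → |z.re| * ‖u‖ ≤ ‖y‖)
    (hB : Differentiable ℂ B)
    (hBT : ∀ z, pencil J z * B z = J * (algebraMap ℂ (E →L[ℂ] E) (Complex.exp z) - T)) (x : E) :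
    {c : ℂ | ‖c‖ = 1 ∧ ¬ HasLocalSolution (fun z => algebraMap ℂ (E →L[ℂ] E) z - T) x c} =
      closure ((fun ξ : ℝ => Complex.exp (Complex.I * ξ)) ''
        {ξ : ℝ | ¬ HasLocalSolution (pencil J) (J x) (Complex.I * ξ)}) := by
  apply Set.Subset.antisymm
  · rintro c ⟨hc, hsol⟩
    by_contra hcl
    obtain ⟨ε, hε, hball⟩ := Metric.isOpen_iff.1 isClosed_closure.isOpen_compl c hcl
    -- With radius ε/2, each point is within ε of c or strictly outside the disc of the projection,
    -- so the two cases below are exhaustive.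
    refine hsol (hasLocalSolution_of_dampedProjection_eq_zero hT hρ hc (half_pos hε) ?_)
    refine eq_zero_of_forall_hasLocalSolution hJ hdiss fun z => ?_
    by_cases hz : z.re = 0
    · have hzI : z = Complex.I * (z.im : ℂ) := by
        apply Complex.ext <;> simp [hz]
      by_cases hd : ‖Complex.exp z - c‖ < ε
      · have h1 : HasLocalSolution (pencil J) (J x) z := by
          by_contra hns
          refine hball (mem_ball_iff_norm.2 hd) (subset_closure ⟨z.im, ?_, ?_⟩)
          · change ¬ HasLocalSolution (pencil J) (J x) (Complex.I * (z.im : ℂ))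
            rwa [← hzI]
          · change Complex.exp (Complex.I * (z.im : ℂ)) = _
            rw [← hzI]
        obtain ⟨U, G, hU, hmem, hG, hTG⟩ := h1
        set P := dampedProjection T c (ε / 2) with hP
        -- As P commutes with J, it maps local solutions for x to local solutions for P x.
        have hcomm : Commute J P := commute_dampedProjection hT hρ hc (half_pos hε).le hJT
        have happ : ∀ u, J (P u) = P (J u) := fun u =>
          congrArg (fun A : E →L[ℂ] E => A u) hcomm.eq
        refine ⟨U, fun z => P (G z), hU, hmem, fun z hz => (P.analyticAt _).comp (hG z hz),
          fun w hw => ?_⟩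
        have h2 := congrArg P (hTG w hw)
        rw [happ, ← h2]
        change P (G w) + (w - 1) • J (P (G w)) = P (G w + (w - 1) • J (G w))
        rw [happ, map_add, map_smul]
      · exact hasLocalSolution_pencil hB hBT (hasLocalSolution_dampedProjection hT hρ hc
          (half_pos hε).le x (by linarith))
    · refine hasLocalSolution_pencil hB hBT (hasLocalSolution_of_mem_resolventSet (hρ _ ?_) _)
      rw [Complex.norm_exp]
      simpa using hz
  · refine closure_minimal ?_ ?_
    · rintro _ ⟨ξ, hξ, rfl⟩
      refine ⟨?_, fun h => hξ (hasLocalSolution_pencil hB hBT h)⟩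
      change ‖Complex.exp (Complex.I * ξ)‖ = 1
      rw [mul_comm, Complex.norm_exp_ofReal_mul_I]
    · refine (isClosed_eq continuous_norm continuous_const).inter ?_
      refine isClosed_compl_iff.2 (isOpen_iff_mem_nhds.2 ?_)
      -- A local solution at c is one at every point of U, so the complement is open.
      rintro c ⟨U, G, hU, hmem, hG, hTG⟩
      filter_upwards [hU.mem_nhds hmem] with w hw using ⟨U, G, hU, hw, hG, hTG⟩

end SpectralMapping

/-- The bounded operators on a normed space, with the operator norm. -/
abbrev Endo (E : Type*) [NormedAddCommGroup E] [NormedSpace ℂ E] : Type _ := E →L[ℂ] E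

/-! ### Completeness of the quotient and the operators induced on it. -/

section Quotient

variable {X : Type*} [NormedAddCommGroup X] [NormedSpace ℂ X]

instance completeSpace_BUC [CompleteSpace X] : CompleteSpace (BUC X) := by
  have hclosed : IsClosed (BUC X : Set (ℝ≥0 →ᵇ X)) := by
    refine IsSeqClosed.isClosed fun u f hu hf => ?_
    exact (BoundedContinuousFunction.tendsto_iff_tendstoUniformly.1 hf).uniformContinuous
      (Frequently.of_forall hu)
  exact hclosed.completeSpace_coe

instance completeSpace_Y [CompleteSpace X] : CompleteSpace (Y X) :=
  Submodule.Quotient.completeSpace (C0 X)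

theorem cls_surjective : Function.Surjective (cls : BUC X → Y X) := (C0 X).mkQ_surjective

theorem norm_cls_le (f : BUC X) : ‖(cls f : Y X)‖ ≤ ‖f‖ := Submodule.Quotient.norm_mk_le (C0 X) f

theorem exists_cls_eq_norm_lt (y : Y X) {ε : ℝ} (hε : 0 < ε) :
    ∃ f : BUC X, cls f = y ∧ ‖f‖ < ‖y‖ + ε :=
  QuotientAddGroup.exists_norm_mk_lt (S := (C0 X).toAddSubgroup) y hε

theorem cls_eq_cls_iff {f g : BUC X} : (cls f : Y X) = cls g ↔ f - g ∈ C0 X :=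
  Submodule.Quotient.eq (C0 X)

/-- The operator on `𝕐` induced by an operator on `BUC` that preserves `C₀`. -/
def induced (A : BUC X →L[ℂ] BUC X) (hA : ∀ f ∈ C0 X, A f ∈ C0 X) : Endo (Y X) :=
  (C0 X).liftQL ((C0 X).mkQL.comp A) fun f hf => by
    rw [LinearMap.mem_ker]
    exact (Submodule.Quotient.mk_eq_zero (C0 X)).2 (hA f hf)

theorem induced_cls (A : BUC X →L[ℂ] BUC X) (hA : ∀ f ∈ C0 X, A f ∈ C0 X) (f : BUC X) :
    induced A hA (cls f) = cls (A f) := rfl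

theorem norm_induced_apply_le {A : BUC X →L[ℂ] BUC X} (hA : ∀ f ∈ C0 X, A f ∈ C0 X) {C : ℝ}
    (hC0 : 0 ≤ C) (hC : ∀ f, ‖A f‖ ≤ C * ‖f‖) (y : Y X) : ‖induced A hA y‖ ≤ C * ‖y‖ := by
  refine le_of_forall_pos_le_add fun ε hε => ?_
  -- Dividing by C + 1 rather than C covers C = 0.
  obtain ⟨f, rfl, hf⟩ := exists_cls_eq_norm_lt y (ε := ε / (C + 1)) (by positivity)
  rw [induced_cls]
  calc ‖(cls (A f) : Y X)‖ ≤ C * ‖f‖ := (norm_cls_le _).trans (hC f)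
    _ ≤ C * (‖(cls f : Y X)‖ + ε / (C + 1)) := mul_le_mul_of_nonneg_left hf.le hC0
    _ = C * ‖(cls f : Y X)‖ + C / (C + 1) * ε := by ring
    _ ≤ C * ‖(cls f : Y X)‖ + ε := by
      have : C / (C + 1) ≤ 1 := (div_le_one (by positivity)).2 (by linarith)
      nlinarith

end Quotient

/-! ### Translations are invertible isometries of the quotient. -/

section Shift

theorem norm_le_one_of_mem_spectrum {E : Type*} [NormedAddCommGroup E] [NormedSpace ℂ E]
    [CompleteSpace E] {A : E →L[ℂ] E} (hA : ∀ y, ‖A y‖ ≤ ‖y‖) {k : ℂ} (hk : k ∈ spectrum ℂ A) :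
    ‖k‖ ≤ 1 := by
  have h1 : ‖A‖ ≤ 1 := A.opNorm_le_bound zero_le_one fun y => by rw [one_mul]; exact hA y
  -- Only an inequality: the norm is 0 when E is trivial.
  have h2 : ‖(1 : E →L[ℂ] E)‖ ≤ 1 := ContinuousLinearMap.norm_id_le
  exact (spectrum.norm_le_norm_mul_of_mem hk).trans (mul_le_one₀ h1 (norm_nonneg _) h2)

/-- The spectrum of a unit that is contractive along with its inverse lies on the unit circle. -/
theorem mem_resolventSet_of_units {E : Type*} [NormedAddCommGroup E] [NormedSpace ℂ E]
    [CompleteSpace E] (u : (E →L[ℂ] E)ˣ)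
    (hT : ∀ y, ‖(u : E →L[ℂ] E) y‖ ≤ ‖y‖) (hV : ∀ y, ‖(↑u⁻¹ : E →L[ℂ] E) y‖ ≤ ‖y‖) {l : ℂ}
    (hl : ‖l‖ ≠ 1) : l ∈ resolventSet ℂ (u : E →L[ℂ] E) := by
  by_contra hmem
  have h0 : l ≠ 0 := spectrum.ne_zero_of_mem_of_unit hmem
  have h1 : ‖l‖ ≤ 1 := norm_le_one_of_mem_spectrum hT hmem
  have h2 : ‖l⁻¹‖ ≤ 1 := norm_le_one_of_mem_spectrum hV (spectrum.inv₀_mem hmem)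
  rw [norm_inv] at h2
  exact hl (le_antisymm h1 ((inv_le_one₀ (norm_pos_iff.2 h0)).1 h2))

theorem mem_resolventSet_of_contractive {E : Type*} [NormedAddCommGroup E] [NormedSpace ℂ E]
    [CompleteSpace E] {T V : E →L[ℂ] E} (hTV : ∀ y, T (V y) = y) (hVT : ∀ y, V (T y) = y)
    (hT : ∀ y, ‖T y‖ ≤ ‖y‖) (hV : ∀ y, ‖V y‖ ≤ ‖y‖) {l : ℂ} (hl : ‖l‖ ≠ 1) :
    l ∈ resolventSet ℂ T :=
  mem_resolventSet_of_units ⟨T, V, ContinuousLinearMap.ext hTV, ContinuousLinearMap.ext hVT⟩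
    hT hV hl

variable {X : Type*} [NormedAddCommGroup X] [NormedSpace ℂ X]

theorem uniformContinuous_tsub_const (t : ℝ≥0) : UniformContinuous fun s : ℝ≥0 => s - t := by
  refine (LipschitzWith.of_dist_le_mul (K := 1) fun a b => ?_).uniformContinuous
  rw [NNReal.dist_eq, NNReal.dist_eq, NNReal.coe_sub_def, NNReal.coe_sub_def, NNReal.coe_one,
    one_mul]
  refine (abs_max_sub_max_le_abs _ _ _).trans (le_of_eq ?_)
  congr 1; ring

/-- The delay operator `f ↦ f (· - t)`, where `f` is extended to the left by `f 0`. -/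
def delay (t : ℝ≥0) : BUC X →L[ℂ] BUC X :=
  LinearMap.mkContinuous
    { toFun := fun f => ⟨f.1.compContinuous
        ⟨fun s => s - t, (uniformContinuous_tsub_const t).continuous⟩,
        (show UniformContinuous (f.1 : ℝ≥0 → X) from f.2).comp (uniformContinuous_tsub_const t)⟩
      map_add' := fun _ _ => rfl
      map_smul' := fun _ _ => rfl } 1 (fun f => by
      rw [one_mul]
      exact (BoundedContinuousFunction.norm_le (norm_nonneg f)).2
        fun s => norm_apply_le f (s - t))

@[simp] theorem delay_apply (t : ℝ≥0) (f : BUC X) (s : ℝ≥0) :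
    (delay t f).1 s = f.1 (s - t) := rfl

theorem norm_delay_le (t : ℝ≥0) (f : BUC X) : ‖delay t f‖ ≤ 1 * ‖f‖ := by
  rw [one_mul]
  exact (BoundedContinuousFunction.norm_le (norm_nonneg f)).2 fun s => norm_apply_le f (s - t)

theorem norm_S_le (t : ℝ≥0) (f : BUC X) : ‖S t f‖ ≤ 1 * ‖f‖ := by
  rw [one_mul]
  exact (BoundedContinuousFunction.norm_le (norm_nonneg f)).2 fun s => norm_apply_le f (s + t)

theorem delay_mem_C0 (t : ℝ≥0) {f : BUC X} (hf : f ∈ C0 X) : delay t f ∈ C0 X := by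
  refine (mem_C0.1 hf).comp (tendsto_atTop.2 fun b => ?_)
  filter_upwards [eventually_ge_atTop (b + t)] with s hs using le_tsub_of_add_le_right hs

/-- The inverse of the translation `S̃(t)`. -/
def delayTilde (t : ℝ≥0) : Endo (Y X) := induced (delay t) fun _ => delay_mem_C0 t

theorem Stilde_delayTilde (t : ℝ≥0) (y : Y X) : Stilde t (delayTilde t y) = y := by
  obtain ⟨f, rfl⟩ := cls_surjective y
  rw [delayTilde, induced_cls, Stilde_cls]
  congr 1
  apply Subtype.ext
  ext s
  simp

/-- On `BUC` the delay does not undo the translation, but the error vanishes on [t, ∞) and hence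
lies in `C0`. -/
theorem delayTilde_Stilde (t : ℝ≥0) (y : Y X) : delayTilde t (Stilde t y) = y := by
  obtain ⟨f, rfl⟩ := cls_surjective y
  rw [Stilde_cls, delayTilde, induced_cls, cls_eq_cls_iff, mem_C0]
  refine tendsto_const_nhds.congr' ?_
  filter_upwards [eventually_ge_atTop t] with s hs
  have : (delay t (S t f) - f).1 s = f.1 (s - t + t) - f.1 s := rfl
  rw [this, tsub_add_cancel_of_le hs, sub_self, norm_zero]

theorem norm_Stilde_apply_le (t : ℝ≥0) (y : Y X) : ‖Stilde t y‖ ≤ ‖y‖ := by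
  have := norm_induced_apply_le (A := S t) (fun _ => S_mem_C0 t) zero_le_one (norm_S_le t) y
  rwa [one_mul] at this

theorem norm_delayTilde_apply_le (t : ℝ≥0) (y : Y X) : ‖delayTilde t y‖ ≤ ‖y‖ := by
  have := norm_induced_apply_le (A := delay t) (fun _ => delay_mem_C0 t) zero_le_one
    (norm_delay_le t) y
  rwa [one_mul] at this

theorem norm_Stilde_apply (t : ℝ≥0) (y : Y X) : ‖Stilde t y‖ = ‖y‖ := by
  refine le_antisymm (norm_Stilde_apply_le t y) ?_
  have := norm_delayTilde_apply_le t (Stilde t y)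
  rwa [delayTilde_Stilde] at this

theorem mem_resolventSet_Stilde [CompleteSpace X] (t : ℝ≥0) {l : ℂ} (hl : ‖l‖ ≠ 1) :
    l ∈ resolventSet ℂ (A := Endo (Y X)) (Stilde t) :=
  mem_resolventSet_of_contractive (E := Y X) (V := delayTilde t) (Stilde_delayTilde t)
    (delayTilde_Stilde t) (norm_Stilde_apply_le t) (norm_delayTilde_apply_le t) hl

end Shift

/-! ### Weighted moving averages, bounded and linear in the weight. -/

section Average

variable {X : Type*} [NormedAddCommGroup X] [NormedSpace ℂ X]

open MeasureTheory unitInterval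

theorem integral_unitInterval {F : Type*} [NormedAddCommGroup F] [NormedSpace ℝ F] (g : ℝ → F) :
    ∫ s : I, g s = ∫ s in (0 : ℝ)..1, g s := by
  rw [intervalIntegral.integral_of_le zero_le_one, ← integral_Icc_eq_integral_Ioc]
  exact integral_subtype_comap measurableSet_Icc g

/-- The moving average of `f` with weight `k`. -/
def movingAverage (k : C(I, ℂ)) (f : BUC X) (t : ℝ≥0) : X :=
  ∫ s : I, k s • f.1 (t + toNNReal s)

theorem continuous_averageIntegrand (k : C(I, ℂ)) (f : BUC X) (t : ℝ≥0) :
    Continuous fun s : I => k s • f.1 (t + toNNReal s) :=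
  k.continuous.smul (f.1.continuous.comp (continuous_const.add toNNReal_continuous))

theorem integrable_of_continuous_unitInterval {F : Type*} [NormedAddCommGroup F] {g : I → F}
    (hg : Continuous g) : Integrable g :=
  hg.integrable_of_hasCompactSupport (HasCompactSupport.of_compactSpace g)

theorem norm_integral_smul_le (k : C(I, ℂ)) {g : I → X} {C : ℝ}
    (hg : ∀ s, ‖g s‖ ≤ C) : ‖∫ s : I, k s • g s‖ ≤ (∫ s : I, ‖k s‖) * C := by
  rw [← integral_mul_const]
  refine norm_integral_le_of_norm_le ((integrable_of_continuous_unitInterval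
    k.continuous.norm).mul_const C) (ae_of_all _ fun s => ?_)
  rw [norm_smul]
  exact mul_le_mul_of_nonneg_left (hg s) (norm_nonneg _)

theorem integral_norm_nonneg (k : C(I, ℂ)) : 0 ≤ ∫ s : I, ‖k s‖ :=
  integral_nonneg fun _ => norm_nonneg _

theorem movingAverage_sub (k : C(I, ℂ)) (f : BUC X) (t t' : ℝ≥0) :
    movingAverage k f t - movingAverage k f t' =
      ∫ s : I, k s • (f.1 (t + toNNReal s) - f.1 (t' + toNNReal s)) := by
  rw [movingAverage, movingAverage, ← integral_sub
    (integrable_of_continuous_unitInterval (continuous_averageIntegrand k f t))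
    (integrable_of_continuous_unitInterval (continuous_averageIntegrand k f t'))]
  simp only [smul_sub]

theorem uniformContinuous_movingAverage (k : C(I, ℂ)) (f : BUC X) :
    UniformContinuous (movingAverage k f) := by
  refine Metric.uniformContinuous_iff.2 fun ε hε => ?_
  have hpos : 0 < (∫ s : I, ‖k s‖) + 1 := by linarith [integral_norm_nonneg k]
  obtain ⟨δ, hδ, hf⟩ := Metric.uniformContinuous_iff.1 f.2 (ε / ((∫ s : I, ‖k s‖) + 1))
    (by positivity)
  refine ⟨δ, hδ, fun a b hab => ?_⟩
  rw [dist_eq_norm, movingAverage_sub]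
  refine (norm_integral_smul_le k (C := ε / ((∫ s : I, ‖k s‖) + 1)) fun s => ?_).trans_lt ?_
  · rw [← dist_eq_norm]
    refine (hf ?_).le
    simpa [NNReal.dist_eq] using hab
  · rw [mul_div_assoc', div_lt_iff₀ hpos]
    linarith

theorem norm_movingAverage_le (k : C(I, ℂ)) (f : BUC X) (t : ℝ≥0) :
    ‖movingAverage k f t‖ ≤ (∫ s : I, ‖k s‖) * ‖f‖ :=
  norm_integral_smul_le k fun _ => norm_apply_le f _

theorem integral_norm_le (k : C(I, ℂ)) : ∫ s : I, ‖k s‖ ≤ ‖k‖ := by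
  have := integral_mono (integrable_of_continuous_unitInterval k.continuous.norm)
    (integrable_const ‖k‖) fun s => k.norm_coe_le_norm s
  simpa using this

/-- The moving average with weight `k`, as an operator on `BUC`. -/
def average (k : C(I, ℂ)) : BUC X →L[ℂ] BUC X :=
  LinearMap.mkContinuous
    { toFun := fun f => ⟨BoundedContinuousFunction.ofNormedAddCommGroup (movingAverage k f)
        (uniformContinuous_movingAverage k f).continuous _ (norm_movingAverage_le k f),
        uniformContinuous_movingAverage k f⟩
      map_add' := fun f g => by
        apply Subtype.ext
        ext t
        change movingAverage k (f + g) t = movingAverage k f t + movingAverage k g t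
        rw [movingAverage, movingAverage, movingAverage, ← integral_add
          (integrable_of_continuous_unitInterval (continuous_averageIntegrand k f t))
          (integrable_of_continuous_unitInterval (continuous_averageIntegrand k g t))]
        exact integral_congr_ae (ae_of_all _ fun s => smul_add _ _ _)
      map_smul' := fun c f => by
        apply Subtype.ext
        ext t
        change movingAverage k (c • f) t = c • movingAverage k f t
        rw [movingAverage, movingAverage, ← integral_smul]
        exact integral_congr_ae (ae_of_all _ fun s => smul_comm _ _ _) } (∫ s : I, ‖k s‖)
    fun f => (BoundedContinuousFunction.norm_le
      (mul_nonneg (integral_norm_nonneg k) (norm_nonneg f))).2 (norm_movingAverage_le k f)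

theorem average_apply (k : C(I, ℂ)) (f : BUC X) (t : ℝ≥0) :
    (average k f).1 t = ∫ s : I, k s • f.1 (t + toNNReal s) := rfl

theorem norm_average_le (k : C(I, ℂ)) (f : BUC X) :
    ‖average k f‖ ≤ (∫ s : I, ‖k s‖) * ‖f‖ :=
  (BoundedContinuousFunction.norm_le
    (mul_nonneg (integral_norm_nonneg k) (norm_nonneg f))).2 (norm_movingAverage_le k f)

theorem average_mem_C0 (k : C(I, ℂ)) {f : BUC X} (hf : f ∈ C0 X) : average k f ∈ C0 X := by
  rw [mem_C0, Metric.tendsto_atTop] at hf ⊢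
  intro ε hε
  have hpos : 0 < (∫ s : I, ‖k s‖) + 1 := by linarith [integral_norm_nonneg k]
  obtain ⟨N, hN⟩ := hf (ε / ((∫ s : I, ‖k s‖) + 1)) (by positivity)
  refine ⟨N, fun t ht => ?_⟩
  rw [dist_zero_right, norm_norm, average_apply]
  refine (norm_integral_smul_le k (C := ε / ((∫ s : I, ‖k s‖) + 1)) fun s => ?_).trans_lt ?_
  · have := hN (t + toNNReal s) (le_add_right ht)
    rw [dist_zero_right, norm_norm] at this
    exact this.le
  · rw [mul_div_assoc', div_lt_iff₀ hpos]
    linarith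

/-- The moving average with weight `k`, as an operator on `𝕐`. -/
def averageTilde : C(I, ℂ) →L[ℂ] Endo (Y X) :=
  LinearMap.mkContinuous
    { toFun := fun k => induced (average k) fun _ => average_mem_C0 k
      map_add' := fun k l => by
        refine ContinuousLinearMap.ext fun y => ?_
        obtain ⟨f, rfl⟩ := cls_surjective y
        refine congrArg cls (Subtype.ext (BoundedContinuousFunction.ext fun t => ?_))
        change (average (k + l) f).1 t = (average k f).1 t + (average l f).1 t
        rw [average_apply, average_apply, average_apply, ← integral_add
          (integrable_of_continuous_unitInterval (continuous_averageIntegrand k f t))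
          (integrable_of_continuous_unitInterval (continuous_averageIntegrand l f t))]
        exact integral_congr_ae (ae_of_all _ fun s => add_smul _ _ _)
      map_smul' := fun c k => by
        refine ContinuousLinearMap.ext fun y => ?_
        obtain ⟨f, rfl⟩ := cls_surjective y
        refine congrArg cls (Subtype.ext (BoundedContinuousFunction.ext fun t => ?_))
        change (average (c • k) f).1 t = c • (average k f).1 t
        rw [average_apply, average_apply, ← integral_smul]
        exact integral_congr_ae (ae_of_all _ fun s => smul_assoc c (k s) _) } 1 fun k => by
    rw [one_mul]
    exact (ContinuousLinearMap.opNorm_le_bound _ (integral_norm_nonneg k)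
      (norm_induced_apply_le (fun _ => average_mem_C0 k) (integral_norm_nonneg k) (norm_average_le k))).trans
      (integral_norm_le k)

theorem averageTilde_cls (k : C(I, ℂ)) (f : BUC X) :
    averageTilde k (cls f : Y X) = cls (average k f) := rfl

theorem norm_averageTilde_apply_le (k : C(I, ℂ)) (y : Y X) :
    ‖averageTilde k y‖ ≤ (∫ s : I, ‖k s‖) * ‖y‖ :=
  norm_induced_apply_le (fun _ => average_mem_C0 k) (integral_norm_nonneg k) (norm_average_le k) y

theorem commute_averageTilde_Stilde (k : C(I, ℂ)) (t : ℝ≥0) :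
    Commute (S := Endo (Y X)) (averageTilde k) (Stilde t) := by
  refine ContinuousLinearMap.ext fun y => ?_
  obtain ⟨f, rfl⟩ := cls_surjective y
  change averageTilde k (Stilde t (cls f)) = Stilde t (averageTilde k (cls f))
  rw [Stilde_cls, averageTilde_cls, averageTilde_cls, Stilde_cls]
  refine congrArg cls (Subtype.ext (BoundedContinuousFunction.ext fun s => ?_))
  rw [S_apply, average_apply, average_apply]
  simp only [S_apply, add_right_comm]

end Average

/-! ### The exponential weight as an entire function with values in C([0,1]). -/

section ExpWeight

theorem differentiable_clm_comp {F G : Type*} [NormedAddCommGroup F] [NormedSpace ℂ F]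
    [NormedAddCommGroup G] [NormedSpace ℂ G] (A : F →L[ℂ] G) {k : ℂ → F}
    (hk : Differentiable ℂ k) : Differentiable ℂ fun z => A (k z) :=
  A.differentiable.comp hk

open MeasureTheory unitInterval

/-- The weight `s ↦ e^{z (1 - s)}` on the unit interval. -/
def expWeight (z : ℂ) : C(I, ℂ) := ⟨fun s => Complex.exp (z * (1 - (s : ℝ))), by fun_prop⟩

theorem expWeight_apply (z : ℂ) (s : I) :
    expWeight z s = Complex.exp (z * (1 - (s : ℝ))) := rfl

/-- The weight is the exponential of z times the function 1 - s in the Banach algebra `C(I, ℂ)`. -/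
theorem differentiable_expWeight : Differentiable ℂ expWeight := by
  let e : C(I, ℂ) := ⟨fun s => 1 - ((s : ℝ) : ℂ), by fun_prop⟩
  have h : expWeight = fun z => NormedSpace.exp (z • e) := by
    funext z
    ext s
    have h1 := NormedSpace.map_exp (ContinuousMap.evalAlgHom ℂ ℂ s)
      (continuous_eval_const s) (z • e)
    rw [← Complex.exp_eq_exp_ℂ] at h1
    exact h1.symm
  rw [h]
  exact fun z => (hasDerivAt_exp_smul_const e z).differentiableAt

theorem norm_expWeight (z : ℂ) (s : I) : ‖expWeight z s‖ = Real.exp (z.re * (1 - (s : ℝ))) := by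
  rw [expWeight_apply, Complex.norm_exp]
  congr 1
  have : (1 - ((s : ℝ) : ℂ)) = ((1 - (s : ℝ) : ℝ) : ℂ) := by push_cast; rfl
  rw [this, Complex.re_mul_ofReal]

/-- Kept in product form so that Re z = 0 is included. The factor e^{Re z} - 1 matches the lower
bound for e^z - T. -/
theorem re_mul_integral_norm_expWeight (z : ℂ) :
    z.re * ∫ s : I, ‖expWeight z s‖ = Real.exp z.re - 1 := by
  simp only [norm_expWeight]
  rw [integral_unitInterval (fun s => Real.exp (z.re * (1 - s))),
    ← intervalIntegral.integral_const_mul]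
  have h : ∀ x ∈ Set.uIcc (0 : ℝ) 1, HasDerivAt (fun s => -Real.exp (z.re * (1 - s)))
      (z.re * Real.exp (z.re * (1 - x))) x := fun x _ => by
    have h1 : HasDerivAt (fun s : ℝ => z.re * (1 - s)) (z.re * (-1)) x :=
      ((hasDerivAt_id x).const_sub 1).const_mul _
    convert! h1.exp.neg using 1
    ring
  rw [intervalIntegral.integral_eq_sub_of_hasDerivAt h
    (Continuous.intervalIntegrable (by fun_prop) _ _)]
  simp
  ring

end ExpWeight

/-! ### The operator `Dtilde`, its resolvent, and the identification of both spectra. -/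

section Generator

variable {X : Type*} [NormedAddCommGroup X] [NormedSpace ℂ X]

open MeasureTheory unitInterval

/-- The extension of `f` to `ℝ` by `f 0`. -/
def extend (f : BUC X) (s : ℝ) : X := f.1 s.toNNReal

theorem continuous_extend (f : BUC X) : Continuous (extend f) :=
  f.1.continuous.comp continuous_real_toNNReal

theorem extend_coe (f : BUC X) (t : ℝ≥0) : extend f t = f.1 t := by
  rw [extend, Real.toNNReal_coe]

theorem extend_coe_add (f : BUC X) (t s : ℝ≥0) : extend f ((t : ℝ) + (s : ℝ)) = f.1 (t + s) := by
  rw [← NNReal.coe_add, extend_coe]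

theorem average_expWeight_apply (z : ℂ) (f : BUC X) (t : ℝ≥0) :
    (average (expWeight z) f).1 t =
      ∫ s in (0 : ℝ)..1, Complex.exp (z * (1 - s)) • extend f (t + s) := by
  rw [average_apply, ← integral_unitInterval
    (fun s : ℝ => Complex.exp (z * (1 - s)) • extend f (t + s))]
  simp only [← extend_coe_add, coe_toNNReal, expWeight_apply]

/-- Substituting t + s moves t from the argument of f into the limits of integration, so the average
can be differentiated in t although f is only continuous. -/
theorem average_expWeight_eq (z : ℂ) (f : BUC X) {t : ℝ} (ht : 0 ≤ t) :
    (average (expWeight z) f).1 t.toNNReal = Complex.exp (z * (1 + t)) •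
      ((∫ s in (0 : ℝ)..(t + 1), Complex.exp (-z * s) • extend f s)
        - ∫ s in (0 : ℝ)..t, Complex.exp (-z * s) • extend f s) := by
  have hc : Continuous fun s : ℝ => Complex.exp (-z * s) • extend f s :=
    (by fun_prop : Continuous fun s : ℝ => Complex.exp (-z * s)).smul (continuous_extend f)
  rw [average_expWeight_apply, Real.coe_toNNReal t ht,
    intervalIntegral.integral_interval_sub_left (hc.intervalIntegrable _ _)
      (hc.intervalIntegrable _ _), ← intervalIntegral.integral_smul]
  have h := intervalIntegral.integral_comp_add_left (a := 0) (b := 1)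
    (fun s : ℝ => Complex.exp (z * (1 + t)) • Complex.exp (-z * s) • extend f s) t
  rw [add_zero] at h
  rw [← h]
  refine intervalIntegral.integral_congr fun s _ => ?_
  rw [smul_smul, ← Complex.exp_add]
  congr 2
  push_cast
  ring

/-- `(z - 𝒟) ∫₀¹ e^{z(1-s)} S(s) f ds = e^z f - S(1) f`. -/
theorem isDerivOf_average [CompleteSpace X] (z : ℂ) (f : BUC X) :
    IsDerivOf (average (expWeight z) f)
      (z • average (expWeight z) f - (Complex.exp z • f - S 1 f)) := by
  intro t
  have hc : Continuous fun s : ℝ => Complex.exp (-z * s) • extend f s :=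
    (by fun_prop : Continuous fun s : ℝ => Complex.exp (-z * s)).smul (continuous_extend f)
  have h1 : HasDerivAt (fun s : ℝ => z * (1 + (s : ℂ))) z (t : ℝ) := by
    simpa using ((Complex.ofRealCLM.hasDerivAt (x := (t : ℝ))).const_add 1).const_mul z
  have h2 : HasDerivAt (fun r : ℝ => ∫ s in (0 : ℝ)..r, Complex.exp (-z * s) • extend f s)
      (Complex.exp (-z * ((t : ℝ) : ℂ)) • extend f (t : ℝ)) t :=
    (hc.integral_hasStrictDerivAt 0 (t : ℝ)).hasDerivAt
  have h3 : HasDerivAt (fun r : ℝ => ∫ s in (0 : ℝ)..(r + 1), Complex.exp (-z * s) • extend f s)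
      (Complex.exp (-z * (((t : ℝ) + 1 : ℝ) : ℂ)) • extend f ((t : ℝ) + 1)) t :=
    HasDerivAt.comp_add_const (t : ℝ) 1 (hc.integral_hasStrictDerivAt 0 ((t : ℝ) + 1)).hasDerivAt
  have h4 := (h1.cexp.smul (h3.sub h2)).hasDerivWithinAt (s := Set.Ici 0)
  refine (h4.congr_deriv ?_).congr (fun s hs => average_expWeight_eq z f hs)
    (average_expWeight_eq z f t.coe_nonneg)
  have e1 : extend f (t : ℝ) = f.1 t := extend_coe f t
  have e2 : extend f ((t : ℝ) + 1) = f.1 (t + 1) := extend_coe_add f t 1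
  have e3 := average_expWeight_eq z f t.coe_nonneg
  rw [Real.toNNReal_coe] at e3
  have e4 : Complex.exp (z * (1 + ((t : ℝ) : ℂ))) * Complex.exp (-z * (((t : ℝ) + 1 : ℝ) : ℂ))
      = 1 := by
    rw [← Complex.exp_add]
    refine (congrArg Complex.exp ?_).trans Complex.exp_zero
    push_cast
    ring
  have e5 : Complex.exp (z * (1 + ((t : ℝ) : ℂ))) * Complex.exp (-z * ((t : ℝ) : ℂ))
      = Complex.exp z := by
    rw [← Complex.exp_add]
    congr 1
    ring
  change _ = z • (average (expWeight z) f).1 t - (Complex.exp z • f.1 t - f.1 (t + 1))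
  rw [e3, Pi.sub_apply, smul_sub, smul_smul, smul_smul, e4, e5, one_smul, e1, e2, smul_smul,
    mul_comm z (Complex.exp _)]
  abel

/-- `∫₀¹ e^{z(1-s)} S(s) (z - 𝒟) u ds = e^z u - S(1) u`. -/
theorem average_of_isDerivOf [CompleteSpace X] (z : ℂ) {u v : BUC X} (huv : IsDerivOf u v) :
    average (expWeight z) (z • u - v) = Complex.exp z • u - S 1 u := by
  refine Subtype.ext (BoundedContinuousFunction.ext fun t => ?_)
  rw [average_expWeight_apply]
  have hexp : Continuous fun s : ℝ => Complex.exp (z * (1 - s)) := by fun_prop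
  have hshift : Continuous fun s : ℝ => (t : ℝ) + s := by fun_prop
  have hcont : Continuous fun s : ℝ => -(Complex.exp (z * (1 - s)) • extend u (t + s)) :=
    (hexp.smul ((continuous_extend u).comp hshift)).neg
  -- The integrand is a total derivative in s. The open interval keeps t + x > 0, where the
  -- one-sided derivative of u is two-sided.
  have hderiv : ∀ x ∈ Set.Ioo (0 : ℝ) 1,
      HasDerivAt (fun s : ℝ => -(Complex.exp (z * (1 - s)) • extend u (t + s)))
        (Complex.exp (z * (1 - x)) • extend (z • u - v) (t + x)) x := fun x hx => by
    have hpos : 0 < (t : ℝ) + x := add_pos_of_nonneg_of_pos t.2 hx.1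
    have h1 : HasDerivAt (fun s : ℝ => z * (1 - (s : ℂ))) (-z) x := by
      simpa using ((Complex.ofRealCLM.hasDerivAt (x := x)).const_sub 1).const_mul z
    have h2 := huv ((t : ℝ) + x).toNNReal
    rw [Real.coe_toNNReal _ hpos.le] at h2
    have h3 : HasDerivAt (fun s : ℝ => extend u (t + s)) (extend v (t + x)) x :=
      HasDerivAt.comp_const_add (t : ℝ) x (h2.hasDerivAt (Ici_mem_nhds hpos))
    refine (h1.cexp.smul h3).neg.congr_deriv ?_
    have h4 : extend (z • u - v) ((t : ℝ) + x) = z • extend u (t + x) - extend v (t + x) := rfl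
    rw [h4, smul_sub, smul_smul, mul_neg, neg_smul]
    abel
  rw [intervalIntegral.integral_eq_sub_of_hasDerivAt_of_le zero_le_one hcont.continuousOn hderiv
    ((hexp.smul ((continuous_extend _).comp hshift)).intervalIntegrable _ _)]
  have e1 : extend u ((t : ℝ) + 0) = u.1 t := by rw [add_zero, extend_coe]
  have e2 : extend u ((t : ℝ) + 1) = u.1 (t + 1) := extend_coe_add u t 1
  change _ = Complex.exp z • u.1 t - u.1 (t + 1)
  rw [e1, e2]
  simp
  abel

/-- The operator `∫₀¹ e^{z(1-s)} S̃(s) ds`. -/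
def expAverage (z : ℂ) : Endo (Y X) := averageTilde (expWeight z)

theorem differentiable_expAverage : Differentiable ℂ (expAverage : ℂ → Endo (Y X)) :=
  differentiable_clm_comp (F := C(I, ℂ)) (G := Endo (Y X)) averageTilde differentiable_expWeight

theorem expAverage_mem_graph [CompleteSpace X] (z : ℂ) (y : Y X) :
    (expAverage z y, z • expAverage z y - (Complex.exp z • y - Stilde 1 y)) ∈
      (Dtilde X).graph := by
  obtain ⟨f, rfl⟩ := cls_surjective y
  exact mem_Dtilde_graph.2 ⟨_, _, isDerivOf_average z f, rfl, rfl⟩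

theorem expAverage_of_mem_graph [CompleteSpace X] (z : ℂ) {u w : Y X} (h : (u, w) ∈ (Dtilde X).graph) :
    expAverage z (z • u - w) = Complex.exp z • u - Stilde 1 u := by
  obtain ⟨f, g, hfg, rfl, rfl⟩ := mem_Dtilde_graph.1 h
  exact congrArg cls (average_of_isDerivOf z hfg)

theorem commute_expAverage_resolvent (z l : ℂ) :
    Commute (expAverage z : Endo (Y X)) (resolvent (A := Endo (Y X)) (Stilde 1) l) :=
  commute_resolvent (E := Y X) (commute_averageTilde_Stilde _ 1) l

/-- The resolvent of `𝒟̃` off the imaginary axis. -/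
def resolventDtilde (z : ℂ) : Endo (Y X) :=
  expAverage z * resolvent (A := Endo (Y X)) (Stilde 1) (Complex.exp z)

theorem exp_mem_resolventSet [CompleteSpace X] {z : ℂ} (hz : z.re ≠ 0) :
    Complex.exp z ∈ resolventSet ℂ (A := Endo (Y X)) (Stilde 1) := by
  refine mem_resolventSet_Stilde 1 ?_
  rw [Complex.norm_exp]
  simpa using hz

theorem smul_sub_Stilde (l : ℂ) (y : Y X) :
    l • y - Stilde 1 y = (algebraMap ℂ (Endo (Y X)) l - Stilde 1 : Endo (Y X)) y := by
  rw [Algebra.algebraMap_eq_smul_one]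
  rfl

theorem resolventDtilde_mem_graph [CompleteSpace X] {z : ℂ} (hz : z.re ≠ 0) (y : Y X) :
    (resolventDtilde z y, z • resolventDtilde z y - y) ∈ (Dtilde X).graph := by
  have h := expAverage_mem_graph z (resolvent (A := Endo (Y X)) (Stilde 1) (Complex.exp z) y)
  have h2 := congrArg (fun A : Endo (Y X) => A y)
    (sub_mul_resolvent (E := Y X) (exp_mem_resolventSet hz))
  rw [smul_sub_Stilde] at h
  have h3 : (algebraMap ℂ (Endo (Y X)) (Complex.exp z) - Stilde 1 : Endo (Y X))
      (resolvent (A := Endo (Y X)) (Stilde 1) (Complex.exp z) y) = y := h2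
  rw [h3] at h
  exact h

/-- Left inverse: B(z) commutes with the resolvent of T, and B(z) (z - 𝒟̃) u = (e^z - T) u. -/
theorem resolventDtilde_of_mem_graph [CompleteSpace X] {z : ℂ} (hz : z.re ≠ 0) {u w : Y X}
    (h : (u, w) ∈ (Dtilde X).graph) : resolventDtilde z (z • u - w) = u := by
  have h1 := expAverage_of_mem_graph z h
  have h2 : resolventDtilde z (z • u - w) =
      resolvent (A := Endo (Y X)) (Stilde 1) (Complex.exp z) (expAverage z (z • u - w)) :=
    congrArg (fun A : Endo (Y X) => A (z • u - w)) (commute_expAverage_resolvent z _).eq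
  rw [h2, h1, smul_sub_Stilde]
  exact congrArg (fun A : Endo (Y X) => A u)
    (Ring.inverse_mul_cancel _ (exp_mem_resolventSet (X := X) hz))

/-- The graph of `𝒟̃` in terms of the resolvent at `1`. -/
theorem mem_graph_iff_pencil [CompleteSpace X] {z : ℂ} {u y : Y X} :
    (u, z • u - y) ∈ (Dtilde X).graph ↔
      pencil (E := Y X) (resolventDtilde 1) z u = (resolventDtilde 1 : Endo (Y X)) y := by
  have hre : (1 : ℂ).re ≠ 0 := by simp
  have hp : pencil (E := Y X) (resolventDtilde 1) z u =
    u + (z - 1) • (resolventDtilde 1 : Endo (Y X)) u := rfl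
  have hv : ((1 : ℂ) • u - (z • u - y)) = y - (z - 1) • u := by
    rw [one_smul, sub_smul, one_smul]; abel
  have hJ : (resolventDtilde 1 : Endo (Y X)) (y - (z - 1) • u) =
      (resolventDtilde 1 : Endo (Y X)) y - (z - 1) • (resolventDtilde 1 : Endo (Y X)) u := by
    rw [map_sub, map_smul]
  rw [hp]
  constructor
  · intro h
    have h1 := resolventDtilde_of_mem_graph hre h
    rw [hv, hJ] at h1
    exact (eq_add_of_sub_eq h1).symm
  · intro h
    -- The pencil equation says u = J (y - (z - 1) u), which places u in the domain.
    have h1 := resolventDtilde_mem_graph hre (y - (z - 1) • u)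
    have h2 : (resolventDtilde 1 : Endo (Y X)) (y - (z - 1) • u) = u := by
      rw [hJ, ← h, add_sub_cancel_right]
    rw [h2] at h1
    have h3 : (1 : ℂ) • u - (y - (z - 1) • u) = z • u - y := by
      rw [one_smul, sub_smul, one_smul]; abel
    rwa [h3] at h1

/-- If J y = 0, then (0, -y) lies in the graph, and single-valuedness of 𝒟̃ gives y = 0. -/
theorem injective_resolventDtilde_one [CompleteSpace X] :
    Function.Injective (resolventDtilde 1 : Endo (Y X)) := by
  refine (injective_iff_map_eq_zero _).2 fun y hy => ?_
  have h := resolventDtilde_mem_graph (z := 1) (by simp) y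
  rw [hy, smul_zero, zero_sub] at h
  exact neg_eq_zero.1 ((Dtilde X).graph_fst_eq_zero_snd h rfl)

/-- In (e^z - T) u = B(z) y the left side has norm at least |e^{Re z} - 1| ‖u‖ and the right side at
most ‖y‖ times the integral of the weight's norm; the quotient of the two factors is |Re z|. -/
theorem re_mul_norm_le_of_pencil [CompleteSpace X] (z : ℂ) (u y : Y X)
    (h : pencil (E := Y X) (resolventDtilde 1) z u = (resolventDtilde 1 : Endo (Y X)) y) :
    |z.re| * ‖u‖ ≤ ‖y‖ := by
  have h1 := expAverage_of_mem_graph z (mem_graph_iff_pencil.2 h)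
  rw [sub_sub_cancel] at h1
  have h2 := abs_norm_sub_one_mul_norm_le (E := Y X) (norm_Stilde_apply 1) (Complex.exp z) u
  rw [← smul_sub_Stilde, ← h1, Complex.norm_exp] at h2
  have h3 := h2.trans (norm_averageTilde_apply_le (expWeight z) y)
  rw [← re_mul_integral_norm_expWeight, abs_mul,
    abs_of_nonneg (integral_norm_nonneg (expWeight z))] at h3
  have hpos : 0 < ∫ s : I, ‖expWeight z s‖ := by
    refine (integral_norm_nonneg _).lt_of_ne fun h0 => ?_
    have h4 := re_mul_integral_norm_expWeight z
    rw [← h0, mul_zero, eq_comm, sub_eq_zero, Real.exp_eq_one_iff] at h4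
    simp [norm_expWeight, h4] at h0
  refine le_of_mul_le_mul_left (le_of_eq_of_le ?_ h3) hpos
  ring

theorem pencil_mul_expAverage [CompleteSpace X] (z : ℂ) :
    pencil (E := Y X) (resolventDtilde 1) z * expAverage z =
      (resolventDtilde 1 : Endo (Y X)) *
        (algebraMap ℂ (Endo (Y X)) (Complex.exp z) - Stilde 1 : Endo (Y X)) := by
  refine ContinuousLinearMap.ext fun y => ?_
  have h := mem_graph_iff_pencil.1 (expAverage_mem_graph z y)
  rw [smul_sub_Stilde] at h
  exact h

theorem commute_resolventDtilde_Stilde (z : ℂ) :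
    Commute (S := Endo (Y X)) (resolventDtilde z) (Stilde 1) :=
  Commute.mul_left (commute_averageTilde_Stilde _ 1)
    (commute_resolvent (E := Y X) (Commute.refl _) _).symm

theorem mem_resolventSetPMap_Dtilde [CompleteSpace X] {z : ℂ} (hz : z.re ≠ 0) :
    z ∈ resolventSetPMap (E := Y X) (Dtilde X) := by
  refine ⟨resolventDtilde z, fun x => ?_, fun y => ?_⟩
  · obtain ⟨y, hy, hDy⟩ := (LinearPMap.mem_graph_iff _).1 (resolventDtilde_mem_graph hz x)
    refine ⟨y, hy, ?_⟩
    rw [hDy, hy]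
    exact sub_sub_cancel _ _
  · exact resolventDtilde_of_mem_graph hz ((Dtilde X).mem_graph y)

theorem isResolventOf_resolventPMap {E : Type*} [NormedAddCommGroup E] [NormedSpace ℂ E]
    {A : E →ₗ.[ℂ] E} {z : ℂ} (hz : z ∈ resolventSetPMap A) :
    IsResolventOf A z (resolventPMap A z) := by
  have h : ∃ R, IsResolventOf A z R := hz
  rw [resolventPMap, dif_pos h]
  exact h.choose_spec

theorem mem_sp_iff [CompleteSpace X] (f : BUC X) (ξ : ℝ) :
    ξ ∈ sp f ↔ ¬ HasLocalSolution (E := Y X) (pencil (E := Y X) (resolventDtilde 1))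
      ((resolventDtilde 1 : Endo (Y X)) (cls f)) (Complex.I * ξ) := by
  refine not_congr (hasAnalyticExtensionAt_iff (E := Y X) ?_ ?_ (fun z hz => ?_) (fun z hz => ?_) _)
  · exact continuous_const.add ((continuous_id.sub continuous_const).smul continuous_const)
  · exact dense_re_ne_zero.mono fun z hz => mem_resolventSetPMap_Dtilde hz
  · obtain ⟨y, hy, hDy⟩ := (isResolventOf_resolventPMap (E := Y X) hz).1 (cls f)
    refine mem_graph_iff_pencil.1 ((LinearPMap.mem_graph_iff _).2 ⟨y, hy, ?_⟩)
    have h1 : Dtilde X y = z • (y : Y X) - cls f := by rw [← hDy, sub_sub_cancel]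
    rw [hy] at h1
    exact h1
  -- The resolvent set may contain points of the imaginary axis, so injectivity comes from the
  -- resolvent itself, not from the norm estimate.
  · refine (injective_iff_map_eq_zero
      (pencil (E := Y X) (resolventDtilde 1) z)).2 fun u hu => ?_
    have h := (mem_graph_iff_pencil (y := 0)).2 (hu.trans (map_zero _).symm)
    obtain ⟨y, rfl, hDy⟩ := (LinearPMap.mem_graph_iff _).1 h
    have h2 := (isResolventOf_resolventPMap (E := Y X) hz).2 y
    rw [hDy] at h2
    rw [← h2]
    simp

theorem mem_circularSpectrum_iff [CompleteSpace X] (f : BUC X) (c : ℂ) :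
    c ∈ circularSpectrum f ↔ ‖c‖ = 1 ∧ ¬ HasLocalSolution (E := Y X)
      (fun z => (algebraMap ℂ (Endo (Y X)) z - Stilde 1 : Endo (Y X))) (cls f) c := by
  refine and_congr_right fun _ => not_congr
    (hasAnalyticExtensionAt_iff (E := Y X) ?_ ?_ (fun z hz => ?_) (fun z hz => ?_) _)
  · exact (continuous_algebraMap ℂ (Endo (Y X))).sub continuous_const
  · exact dense_norm_ne_one.mono fun z hz => mem_resolventSet_Stilde 1 hz
  · exact congrArg (fun A : Endo (Y X) => A (cls f)) (sub_mul_resolvent (E := Y X) hz)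
  · refine Function.LeftInverse.injective (g := resolvent (A := Endo (Y X)) (Stilde 1) z)
      fun u => ?_
    exact congrArg (fun A : Endo (Y X) => A u)
      (Ring.inverse_mul_cancel (algebraMap ℂ (Endo (Y X)) z - Stilde 1 : Endo (Y X)) hz)

end Generator

end AsympSpectrum

end

theorem mainTheorem5 {X : Type*} [NormedAddCommGroup X] [NormedSpace ℂ X] [CompleteSpace X]
    (f : AsympSpectrum.BUC X) :
    AsympSpectrum.circularSpectrum f =
      closure ((fun ξ : ℝ => Complex.exp (Complex.I * ξ)) '' AsympSpectrum.sp f) := by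
  have h := AsympSpectrum.localSpectrum_eq_closure (E := AsympSpectrum.Y X)
    (AsympSpectrum.norm_Stilde_apply 1) (fun _ => AsympSpectrum.mem_resolventSet_Stilde 1)
    AsympSpectrum.injective_resolventDtilde_one (AsympSpectrum.commute_resolventDtilde_Stilde 1)
    AsympSpectrum.re_mul_norm_le_of_pencil AsympSpectrum.differentiable_expAverage
    AsympSpectrum.pencil_mul_expAverage (AsympSpectrum.cls f)
  rw [show AsympSpectrum.sp f = _ from Set.ext (AsympSpectrum.mem_sp_iff f)]
  exact (Set.ext (AsympSpectrum.mem_circularSpectrum_iff f)).trans h
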